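/- **Setting.** Let $L\ge 1$, $H,W\ge 1$, let $C=C_0,C_1,\dots,C_{L-1},K,N\ge 0$ be integers, and let $\lambda\ge 0$. Consider the $L$-layer linear convolutional network $$f_w(x)=w^{L,T}\bigl(w^{L-1}*\cdots *w^1 * x\bigr),\qquad f_w:\mathbb R^{C\times H\times W}\to\mathbb R^K,$$ with real weights $w^l\in\mathbb R^{C_l\times H\times W\times C_{l-1}}$ ($1\le l\le L-1$) and $w^L\in\mathbb R^{K\times H\times W\times C_{L-1}}$. The spatial indices are taken modulo $H$ and modulo $W$, and $$(w*x)_{cij}=\sum_{m+m'=i,\ n+n'=j}\ \sum_d w_{cmnd}\,x_{dm'n'},\qquad (u^{T}x)_k=\sum_{d,m,n}u_{kmnd}\,x_{dmn}$$ (the second formula is used for real and for complex tensors). Let $\hat{\ }$ be the unitary discrete Fourier transform in the two spatial indices, $$\hat x_{cij}=\frac1{\sqrt{HW}}\sum_{m,n}x_{cmn}\,e^{-2\pi\imath mi/H-2\pi\imath nj/W},$$ and similarly for $w$. Let $$\hat f_{\hat w}(\hat x)=\hat w^{L,T}\bigl(\hat w^{L-1}\cdots\hat w^1\cdot\hat x\bigr),\qquad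 (\hat w\cdot\hat x)_{cij}=\sum_d\hat w_{cijd}\,\hat x_{dij},$$ be the corresponding network in frequency space. Fix data $x^1,\dots,x^N\in\mathbb R^{C\times H\times W}$ and $y^1,\dots,y^N\in\mathbb R^K$, and an arbitrary loss function $\mathcal L:(\mathbb R^K)^N\times(\mathbb R^K)^N\to\mathbb R$. For a complex $K\times C$ matrix $A$ with singular values $\sigma_1,\dots,\sigma_{\min\{K,C\}}$ and $p>0$ put $\|A\|^S_p=(\sum_i\sigma_i^p)^{1/p}$. Let $\mathcal V$ be the set of all $\hat v\in\mathbb C^{K\times H\times W\times C}$ that are Fourier transforms of real tensors and all of whose $K\times C$ blocks $\hat v_{ij}$ (obtained by fixing the spatial indices) have rank at most $\min\{C,C_1,\dots,C_{L-1},K\}$. **Theorem.** For all real $w$, all $\hat v\in\mathcal V$ and all real $x$, the vectors $\hat f_{\hat w}(\hat x)$ and $\hat v^T\hat x$ are real, and the following holds. 1. The problem $$\min_{\hat w}\ \mathcal L\bigl((\hat f_{\hat w}(\hat x^n))_{n},(y^n)_{n}\bigr)+\lambda\sum_{l=1}^L\|\hat w^l\|_2^2$$ over the Fourier transforms $\hat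 w$ of real weights $w$ is equivalent to $$\min_{\hat v\in\mathcal V}\ \mathcal L\bigl((\hat v^T\hat x^n)_{n},(y^n)_{n}\bigr)+\lambda L\sum_{i,j}\bigl(\|\hat v_{ij}\|^S_{2/L}\bigr)^{2/L},$$ where $\hat w$ corresponds to $\hat v$ if $\hat f_{\hat w}(\hat x)=\hat v^T\hat x$ for all real $x$. 2. The problem $$\min_{w}\ \mathcal L\bigl((f_w(x^n))_{n},(y^n)_{n}\bigr)+\lambda\sum_{l=1}^L\|w^l\|_2^2$$ over real weights $w$ is equivalent to $$\min_{\hat v\in\mathcal V}\ \mathcal L\bigl((\hat v^T\hat x^n)_{n},(y^n)_{n}\bigr)+\lambda L\,(HW)^{-\frac{L-1}{L}}\sum_{i,j}\bigl(\|\hat v_{ij}\|^S_{2/L}\bigr)^{2/L},$$ where $w$ corresponds to $\hat v$ if $f_w(x)=\hat v^T\hat x$ for all real $x$. Here *equivalent* means the following. Every choice of weights corresponds to exactly one $\hat v\in\mathcal V$. For every $\hat v\in\mathcal V$, the value of the second objective at $\hat v$ is the minimum of the first objective over all weights that correspond to $\hat v$. The two problems have the same infimum in $[-\infty,\infty]$,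 and one has a minimum if and only if the other does, with the same value. Minimizing weights correspond to a minimizing $\hat v$, and every minimizing $\hat v$ corresponds to some minimizing weights. -/

import Mathlib

noncomputable section

namespace LinearCNN

/-- A multichannel image with `c` channels and circular spatial indices, `x_{c i j}`. -/
abbrev Image (R : Type) (c H W : ℕ) : Type := Fin c → ZMod H → ZMod W → R

/-- A tensor `w_{c i j d}` with `a` output channels, spatial indices in `ℤ/H × ℤ/W`, and
`b` input channels. -/
abbrev Tensor (R : Type) (a H W b : ℕ) : Type := Fin a → ZMod H → ZMod W → Fin b → R

section Operations

variable {R : Type} {a b H W : ℕ} [NeZero H] [NeZero W]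

/-- Full `H × W` circular convolution:
`(w * x)_{c i j} = ∑_{m + m' = i, n + n' = j} ∑_d w_{c m n d} x_{d m' n'}`. -/
def conv [CommSemiring R] (w : Tensor R a H W b) (x : Image R b H W) : Image R a H W :=
  fun c i j => ∑ m, ∑ n, ∑ d, w c m n d * x d (i - m) (j - n)

/-- Spatially pointwise matrix-vector product: `(w · x)_{c i j} = ∑_d w_{c i j d} x_{d i j}`. -/
def pointwise [CommSemiring R] (w : Tensor R a H W b) (x : Image R b H W) : Image R a H W :=
  fun c i j => ∑ d, w c i j d * x d i j

/-- The (bilinear) contraction `(wᵀ x)_c = ∑_{i, j, d} w_{c i j d} x_{d i j}`. -/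
def contract [CommSemiring R] (w : Tensor R a H W b) (x : Image R b H W) : Fin a → R :=
  fun c => ∑ i, ∑ j, ∑ d, w c i j d * x d i j

/-- Squared Euclidean norm of a tensor. -/
def sqNorm [Norm R] (w : Tensor R a H W b) : ℝ :=
  ∑ c, ∑ i, ∑ j, ∑ d, ‖w c i j d‖ ^ 2

/-- The kernel of the unitary two-dimensional discrete Fourier transform,
`exp (-2πι m i / H - 2πι n j / W) / √(H W)`. -/
def dftKernel (m i : ZMod H) (n j : ZMod W) : ℂ :=
  ((1 / Real.sqrt ((H : ℝ) * W) : ℝ) : ℂ) *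
    (ZMod.stdAddChar (-(m * i)) * ZMod.stdAddChar (-(n * j)))

/-- Discrete Fourier transform of a real image over its two spatial indices. -/
def dftImage (x : Image ℝ a H W) : Image ℂ a H W :=
  fun c i j => ∑ m, ∑ n, (x c m n : ℂ) * dftKernel m i n j

/-- Discrete Fourier transform of a real tensor over its two spatial indices. -/
def dftTensor (w : Tensor ℝ a H W b) : Tensor ℂ a H W b :=
  fun c i j d => ∑ m, ∑ n, (w c m n d : ℂ) * dftKernel m i n j

/-- The matrix obtained by fixing the spatial indices of a tensor. -/
def block (v : Tensor R a H W b) (i : ZMod H) (j : ZMod W) : Matrix (Fin a) (Fin b) R :=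
  Matrix.of fun c d => v c i j d

end Operations

/-- The Schatten `p`-(quasi-)norm `(∑_{i < min (a, b)} σ_i ^ p) ^ (1 / p)`, where
`σ_0 ≥ σ_1 ≥ …` are the singular values of the complex `a × b` matrix `A`. -/
def schatten {a b : ℕ} (p : ℝ) (A : Matrix (Fin a) (Fin b) ℂ) : ℝ :=
  (∑ i ∈ Finset.range (min a b), (Matrix.toEuclideanLin A).singularValues i ^ p) ^ (1 / p)

/-- Weights of a network with `n` convolutional layers and one final contraction, hence of depth
`L = n + 1`. `C 0` is the number of input channels, `C 1, …, C n` are the numbers of channels of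
the hidden layers, and `K` is the number of outputs. -/
structure Weights (R : Type) {n : ℕ} (C : Fin (n + 1) → ℕ) (K H W : ℕ) : Type where
  layer : ∀ l : Fin n, Tensor R (C l.succ) H W (C l.castSucc)
  final : Tensor R K H W (C (Fin.last n))

section Networks

variable {n K H W : ℕ} [NeZero H] [NeZero W] {C : Fin (n + 1) → ℕ}

/-- The sum of the squared Euclidean norms of all `L = n + 1` weight tensors. -/
def Weights.sqNormSum {R : Type} [Norm R] (w : Weights R C K H W) : ℝ :=
  (∑ l, sqNorm (w.layer l)) + sqNorm w.final

/-- The discrete Fourier transform of all the weights. -/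
def Weights.dft (w : Weights ℝ C K H W) : Weights ℂ C K H W where
  layer l := dftTensor (w.layer l)
  final := dftTensor w.final

/-- The linear CNN `f (x) = w^{L,T} (w^{L-1} * ⋯ * w^1 * x)`. -/
def Weights.cnn (w : Weights ℝ C K H W) (x : Image ℝ (C 0) H W) : Fin K → ℝ :=
  contract w.final
    (Fin.induction (motive := fun l => Image ℝ (C l) H W) x
      (fun l z => conv (w.layer l) z) (Fin.last n))

/-- The frequency space network `w^{L,T} (w^{L-1} · ⋯ · w^1 · x)`, in which the convolutions are
replaced by spatially pointwise products. -/
def Weights.freqNet (w : Weights ℂ C K H W) (x : Image ℂ (C 0) H W) : Fin K → ℂ :=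
  contract w.final
    (Fin.induction (motive := fun l => Image ℂ (C l) H W) x
      (fun l z => pointwise (w.layer l) z) (Fin.last n))

/-- The feasible end-to-end tensors in frequency space: Fourier transforms `v̂` of real
`K × H × W × C` tensors such that each `K × C` block `v̂_{ij}` has rank at most
`min {C, C_1, …, C_{L-1}, K}`. -/
def feasible {n : ℕ} (C : Fin (n + 1) → ℕ) (K H W : ℕ) [NeZero H] [NeZero W] :
    Set (Tensor ℂ K H W (C 0)) :=
  {v | (∃ u : Tensor ℝ K H W (C 0), v = dftTensor u) ∧
    ∀ i j, (block v i j).rank ≤ min (⨅ l, C l) K}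

/-- The sum over all frequencies of the `2/L`-th powers of the Schatten `2/L`-quasi-norms of the
blocks. -/
def schattenPenalty (L : ℕ) {a b : ℕ} (v : Tensor ℂ a H W b) : ℝ :=
  ∑ i, ∑ j, schatten (2 / (L : ℝ)) (block v i j) ^ (2 / (L : ℝ))

end Networks

/-- Minimizing `J` over all of `α` is equivalent to minimizing `J'` over `S`, where `Rep a b` says
that `b` is the variable of the second problem that corresponds to the variable `a` of the first
one. -/
structure EquivalentMinimization {α β : Type} (J : α → ℝ) (S : Set β) (J' : β → ℝ)
    (Rep : α → β → Prop) : Prop where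
  /-- Each `a` corresponds to exactly one feasible `b`. -/
  existsUnique : ∀ a, ∃! b, b ∈ S ∧ Rep a b
  /-- The value `J' b` is the minimum of `J` over all `a` that correspond to `b`. -/
  isLeast_fiber : ∀ b ∈ S, IsLeast (J '' {a | Rep a b}) (J' b)
  /-- The infima agree (also if they are `-∞`). -/
  iInf_eq : (⨅ a, (J a : EReal)) = ⨅ b ∈ S, (J' b : EReal)
  /-- The minimum of one problem exists if and only if the other one does, with the same value. -/
  isLeast_iff : ∀ m, IsLeast (Set.range J) m ↔ IsLeast (J' '' S) m
  /-- Minimizers of the first problem yield minimizers of the second one. -/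
  minimizer_of : ∀ a, IsMinOn J Set.univ a → ∀ b ∈ S, Rep a b → IsMinOn J' S b
  /-- Every minimizer of the second problem comes from a minimizer of the first one. -/
  exists_minimizer : ∀ b ∈ S, IsMinOn J' S b → ∃ a, Rep a b ∧ IsMinOn J Set.univ a

end LinearCNN

end

/-! In frequency space the network decouples: each block of the end-to-end tensor is a product of `L
= n + 1` matrices, and the penalty is the sum of their squared Frobenius norms. The question becomes
how cheaply a matrix with singular values σ_i factors through the given widths; the answer is L ∑
σ_i^(2/L).

Lower bound (`IsThinSVD.le_of_chain`): push the right singular vectors through the layers and apply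
Gram–Schmidt after each one. The i-th length starts at 1, ends at σ_i, and in each layer grows at
most by the factor by which that layer stretches the i-th normalized vector. Hence σ_i is at most a
product of L stretches. AM–GM bounds L σ_i^(2/L) by the sum of their squares, and Bessel's
inequality bounds the sum over i within a layer by its squared Frobenius norm. Equality
(`IsThinSVD.exists_chain`): put diag(σ_i^(1/L)) between isometries in every layer.

Weights are real exactly when the factors at opposite frequencies are conjugate. For q ≠ -q one
factors at one of the two and conjugates; for q = -q the block is real and a real SVD is used
(`exists_weights_of_mem_feasible`).

For the CNN, the unitary transform turns each convolution into √(HW) times a pointwise product, and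
Parseval turns the last contraction into one with reflected weights. A surjective rescaling of the
weights (`Weights.freqNet_rescale`) absorbs both and reduces the second problem to the first with
another λ. -/

noncomputable section

namespace LinearCNN

open InnerProductSpace Matrix ComplexConjugate

/-! ### Gram–Schmidt under linear maps -/

section GramSchmidt

variable {𝕜 E F : Type*} [RCLike 𝕜] [NormedAddCommGroup E] [InnerProductSpace 𝕜 E]
  [NormedAddCommGroup F] [InnerProductSpace 𝕜 F] {r : ℕ}

theorem inner_gramSchmidt_self (f : Fin r → E) (i : Fin r) :
    inner 𝕜 (gramSchmidt 𝕜 f i) (f i) = (‖gramSchmidt 𝕜 f i‖ : 𝕜) ^ 2 := by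
  conv_lhs => rw [gramSchmidt_def'' 𝕜 f i]
  rw [inner_add_right, inner_sum, inner_self_eq_norm_sq_to_K, Finset.sum_eq_zero, add_zero]
  intro j hj
  rw [inner_smul_right, gramSchmidt_orthogonal 𝕜 f (Finset.mem_Iio.1 hj).ne', mul_zero]

theorem sub_gramSchmidt_mem_span (f : Fin r → E) (i : Fin r) :
    f i - gramSchmidt 𝕜 f i ∈ Submodule.span 𝕜 (f '' Set.Iio i) := by
  rw [← span_gramSchmidt_Iio 𝕜 f i]
  nth_rewrite 1 [gramSchmidt_def'' 𝕜 f i]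
  rw [add_sub_cancel_left]
  exact Submodule.sum_mem _ fun j hj => Submodule.smul_mem _ _
    (Submodule.subset_span ⟨j, Finset.mem_Iio.1 hj, rfl⟩)

/-- A linear map sends Gram–Schmidt vectors to vectors that are at least as long as the
Gram–Schmidt vectors of the image family. -/
theorem norm_gramSchmidt_map_le (T : E →ₗ[𝕜] F) (f : Fin r → E) (i : Fin r) :
    ‖gramSchmidt 𝕜 (fun j => T (f j)) i‖ ≤ ‖T (gramSchmidt 𝕜 f i)‖ := by
  set g := gramSchmidt 𝕜 (fun j => T (f j)) i with hg
  have hspan : ∀ x ∈ Submodule.span 𝕜 (f '' Set.Iio i), inner 𝕜 g (T x) = 0 := by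
    intro x hx
    induction hx using Submodule.span_induction with
    | mem x hx =>
      obtain ⟨j, hj, rfl⟩ := hx
      exact gramSchmidt_inv_triangular 𝕜 (fun j => T (f j)) hj
    | zero => simp
    | add x y _ _ hx hy => rw [map_add, inner_add_right, hx, hy, add_zero]
    | smul a x _ hx => rw [map_smul, inner_smul_right, hx, mul_zero]
  -- Replacing the Gram–Schmidt vector by `f i` changes it only within the span of earlier vectors,
  -- whose images are orthogonal to `g`.
  have h1 : inner 𝕜 g (T (gramSchmidt 𝕜 f i)) = (‖g‖ : 𝕜) ^ 2 := by
    rw [← inner_gramSchmidt_self (fun j => T (f j)) i, ← sub_eq_zero, ← inner_sub_right,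
      ← map_sub, ← neg_sub, map_neg, inner_neg_right, hspan _ (sub_gramSchmidt_mem_span f i),
      neg_zero]
  have h2 := norm_inner_le_norm (𝕜 := 𝕜) g (T (gramSchmidt 𝕜 f i))
  rw [h1, norm_pow, RCLike.norm_ofReal, abs_norm, sq] at h2
  rcases (norm_nonneg g).eq_or_lt with h | h
  · rw [← h]; positivity
  · exact le_of_mul_le_mul_left h2 h

theorem norm_smul_gramSchmidtNormed (f : Fin r → E) (i : Fin r) :
    (‖gramSchmidt 𝕜 f i‖ : 𝕜) • gramSchmidtNormed 𝕜 f i = gramSchmidt 𝕜 f i := by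
  by_cases h : gramSchmidt 𝕜 f i = 0
  · simp [gramSchmidtNormed, h]
  · rw [gramSchmidtNormed, smul_smul, mul_inv_cancel₀ (by simpa using h), one_smul]

/-- Bessel's inequality: vanishing Gram–Schmidt vectors are normalized to 0 and contribute nothing;
the others are orthonormal. -/
theorem sum_norm_inner_gramSchmidtNormed_le (f : Fin r → E) (x : E) :
    ∑ i, ‖inner 𝕜 (gramSchmidtNormed 𝕜 f i) x‖ ^ 2 ≤ ‖x‖ ^ 2 := by
  classical
  have h := (gramSchmidtNormed_orthonormal' (𝕜 := 𝕜) f).sum_inner_products_le x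
    (s := Finset.univ)
  refine le_trans (le_of_eq ?_) h
  rw [← Finset.sum_subset (Finset.filter_subset
    (fun i => gramSchmidtNormed 𝕜 f i ≠ 0) Finset.univ)]
  · exact Finset.sum_subtype _ (by simp) _
  · intro i _ hi
    have : gramSchmidtNormed 𝕜 f i = 0 := by simpa using hi
    simp [this]

end GramSchmidt

/-! ### Frobenius norm -/

section Frobenius

variable {𝕜 : Type} [RCLike 𝕜] {a b r : ℕ}

/-- The squared Frobenius norm of a matrix. -/
def frobSq (A : Matrix (Fin a) (Fin b) 𝕜) : ℝ := ∑ c, ∑ d, ‖A c d‖ ^ 2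

theorem frobSq_eq_trace (A : Matrix (Fin a) (Fin b) 𝕜) :
    (frobSq A : 𝕜) = (A * Aᴴ).trace := by
  simp only [frobSq, Matrix.trace, Matrix.diag, Matrix.mul_apply, Matrix.conjTranspose_apply]
  push_cast
  refine Finset.sum_congr rfl fun c _ => Finset.sum_congr rfl fun d _ => ?_
  rw [RCLike.star_def, RCLike.mul_conj]

/-- Bessel's inequality for each conjugated row of `A`. -/
theorem sum_norm_map_gramSchmidtNormed_le (A : Matrix (Fin a) (Fin b) 𝕜)
    (f : Fin r → EuclideanSpace 𝕜 (Fin b)) :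
    ∑ i, ‖toEuclideanLin A (gramSchmidtNormed 𝕜 f i)‖ ^ 2 ≤ frobSq A := by
  simp only [EuclideanSpace.norm_sq_eq, frobSq]
  rw [Finset.sum_comm]
  refine Finset.sum_le_sum fun c _ => ?_
  have h := sum_norm_inner_gramSchmidtNormed_le (𝕜 := 𝕜) f
    (WithLp.toLp 2 fun d => star (A c d))
  simp only [EuclideanSpace.norm_sq_eq, norm_star] at h
  refine le_trans (le_of_eq (Finset.sum_congr rfl fun i _ => ?_)) h
  congr 1
  rw [← norm_inner_symm]
  congr 1
  simp [PiLp.inner_apply, Matrix.mulVec, dotProduct, mul_comm]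

end Frobenius

/-! ### Cheapest factorizations of a matrix -/

section Chain

variable {𝕜 : Type} [RCLike 𝕜] {n K r : ℕ} {C : Fin (n + 1) → ℕ}

/-- The partial products `M_{l-1} ⋯ M_0` of a chain of matrices. -/
def chain (M : ∀ l : Fin n, Matrix (Fin (C l.succ)) (Fin (C l.castSucc)) 𝕜) (l : Fin (n + 1)) :
    Matrix (Fin (C l)) (Fin (C 0)) 𝕜 :=
  Fin.induction (motive := fun l => Matrix (Fin (C l)) (Fin (C 0)) 𝕜) 1
    (fun l P => M l * P) l

theorem chain_zero (M : ∀ l : Fin n, Matrix (Fin (C l.succ)) (Fin (C l.castSucc)) 𝕜) :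
    chain M 0 = 1 := rfl

theorem chain_succ (M : ∀ l : Fin n, Matrix (Fin (C l.succ)) (Fin (C l.castSucc)) 𝕜) (l : Fin n) :
    chain M l.succ = M l * chain M l.castSucc := by
  simp [chain]

theorem rank_chain_le (M : ∀ l : Fin n, Matrix (Fin (C l.succ)) (Fin (C l.castSucc)) 𝕜)
    (l k : Fin (n + 1)) (hk : k ≤ l) : (chain M l).rank ≤ C k := by
  induction l using Fin.induction generalizing k with
  | zero =>
    obtain rfl : k = 0 := Fin.le_zero_iff.1 hk
    simpa using Matrix.rank_le_height (chain M 0)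
  | succ l ih =>
    rcases hk.eq_or_lt with rfl | h
    · exact Matrix.rank_le_height _
    · rw [chain_succ]
      exact (Matrix.rank_mul_le_right _ _).trans (ih k (Fin.le_castSucc_iff.2 h))

/-- A thin singular value decomposition `A = U diag(s) Vᴴ`. -/
structure IsThinSVD {a b : ℕ} (A : Matrix (Fin a) (Fin b) 𝕜) (U : Matrix (Fin a) (Fin r) 𝕜)
    (s : Fin r → ℝ) (V : Matrix (Fin b) (Fin r) 𝕜) : Prop where
  nonneg : ∀ i, 0 ≤ s i
  left : Uᴴ * U = 1
  right : Vᴴ * V = 1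
  eq : A = U * Matrix.diagonal (fun i => (s i : 𝕜)) * Vᴴ

/-- AM–GM for the squares `β i ^ 2`. -/
theorem card_mul_prod_rpow_le_sum {m : ℕ} (hm : 0 < m) (β : Fin m → ℝ) (hβ : ∀ i, 0 ≤ β i) :
    (m : ℝ) * (∏ i, β i) ^ (2 / (m : ℝ)) ≤ ∑ i, β i ^ 2 := by
  have h := Real.geom_mean_le_arith_mean Finset.univ (fun _ => (1 : ℝ)) (fun i => β i ^ 2)
    (fun _ _ => zero_le_one) (by simpa using hm) (fun i _ => by positivity)
  simp only [Real.rpow_one, one_mul, Finset.sum_const, Finset.card_univ, Fintype.card_fin,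
    nsmul_eq_mul, mul_one, Finset.prod_pow] at h
  have hm' : (0 : ℝ) < m := by exact_mod_cast hm
  rw [le_div_iff₀ hm', ← Real.rpow_natCast,
    ← Real.rpow_mul (Finset.prod_nonneg fun i _ => hβ i)] at h
  rw [mul_comm]
  simpa [div_eq_mul_inv] using h

theorem le_mul_prod_of_succ_le {n : ℕ} (g : Fin (n + 1) → ℝ) (β : Fin n → ℝ) (hβ : ∀ l, 0 ≤ β l)
    (h : ∀ l : Fin n, g l.succ ≤ g l.castSucc * β l) : g (Fin.last n) ≤ g 0 * ∏ l, β l := by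
  induction n with
  | zero => simp
  | succ n ih =>
    have := ih (fun l => g l.castSucc) (fun l => β l.castSucc) (fun l => hβ _)
      (fun l => h l.castSucc)
    rw [Fin.prod_univ_castSucc, ← mul_assoc]
    exact (h (Fin.last n)).trans (mul_le_mul_of_nonneg_right this (hβ _))

theorem norm_gramSchmidt_step {a b : ℕ} (A : Matrix (Fin a) (Fin b) 𝕜)
    (f : Fin r → EuclideanSpace 𝕜 (Fin b)) (i : Fin r) :
    ‖gramSchmidt 𝕜 (fun j => toEuclideanLin A (f j)) i‖
      ≤ ‖gramSchmidt 𝕜 f i‖ * ‖toEuclideanLin A (gramSchmidtNormed 𝕜 f i)‖ := by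
  refine (norm_gramSchmidt_map_le _ f i).trans (le_of_eq ?_)
  conv_lhs => rw [← norm_smul_gramSchmidtNormed f i, map_smul, norm_smul]
  simp

/-- The columns of a matrix as vectors in Euclidean space. -/
def colVec {a : ℕ} (V : Matrix (Fin a) (Fin r) 𝕜) (i : Fin r) : EuclideanSpace 𝕜 (Fin a) :=
  WithLp.toLp 2 fun c => V c i

theorem toEuclideanLin_colVec {a b : ℕ} (A : Matrix (Fin a) (Fin b) 𝕜)
    (V : Matrix (Fin b) (Fin r) 𝕜) (i : Fin r) :
    toEuclideanLin A (colVec V i) = colVec (A * V) i := by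
  ext c
  simp [colVec, Matrix.mulVec, dotProduct, Matrix.mul_apply]

theorem inner_colVec {a : ℕ} (V : Matrix (Fin a) (Fin r) 𝕜) (i j : Fin r) :
    inner 𝕜 (colVec V i) (colVec V j) = (Vᴴ * V) i j := by
  simp [colVec, PiLp.inner_apply, Matrix.mul_apply, mul_comm]

theorem norm_colVec {a : ℕ} {V : Matrix (Fin a) (Fin r) 𝕜} (hV : Vᴴ * V = 1) (i : Fin r) :
    ‖colVec V i‖ = 1 := by
  have := inner_colVec V i i
  rw [hV, Matrix.one_apply_eq, inner_self_eq_norm_sq_to_K] at this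
  have h : ‖colVec V i‖ ^ 2 = 1 := by exact_mod_cast this
  exact (pow_eq_one_iff_of_nonneg (norm_nonneg _) two_ne_zero).1 h

/-- `β l i` and `γ i` are the stretches of the i-th normalized Gram–Schmidt vector by the hidden
layers and the last one. -/
theorem IsThinSVD.le_of_chain {A : Matrix (Fin K) (Fin (C 0)) 𝕜} {U : Matrix (Fin K) (Fin r) 𝕜}
    {s : Fin r → ℝ} {V : Matrix (Fin (C 0)) (Fin r) 𝕜} (hA : IsThinSVD A U s V)
    (M : ∀ l : Fin n, Matrix (Fin (C l.succ)) (Fin (C l.castSucc)) 𝕜)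
    (F : Matrix (Fin K) (Fin (C (Fin.last n))) 𝕜) (h : F * chain M (Fin.last n) = A) :
    ((n + 1 : ℕ) : ℝ) * ∑ i, s i ^ (2 / ((n + 1 : ℕ) : ℝ)) ≤ (∑ l, frobSq (M l)) + frobSq F := by
  set z : ∀ l : Fin (n + 1), Fin r → EuclideanSpace 𝕜 (Fin (C l)) :=
    fun l => colVec (chain M l * V) with hz
  set β : Fin n → Fin r → ℝ := fun l i =>
    ‖toEuclideanLin (M l) (gramSchmidtNormed 𝕜 (z l.castSucc) i)‖ with hβ
  set γ : Fin r → ℝ := fun i =>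
    ‖toEuclideanLin F (gramSchmidtNormed 𝕜 (z (Fin.last n)) i)‖ with hγ
  have hstep : ∀ (l : Fin n) i, ‖gramSchmidt 𝕜 (z l.succ) i‖
      ≤ ‖gramSchmidt 𝕜 (z l.castSucc) i‖ * β l i := by
    intro l i
    have : z l.succ = fun j => toEuclideanLin (M l) (z l.castSucc j) := by
      funext j
      simp only [hz, toEuclideanLin_colVec, chain_succ, Matrix.mul_assoc]
    rw [this]
    exact norm_gramSchmidt_step _ _ _
  have hz0 : gramSchmidt 𝕜 (z 0) = z 0 := by
    refine gramSchmidt_of_orthogonal 𝕜 fun i j hij => ?_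
    simp [hz, chain_zero, inner_colVec, hA.right, Matrix.one_apply_ne hij]
  have hAV : A * V = U * Matrix.diagonal (fun i => (s i : 𝕜)) := by
    rw [hA.eq, Matrix.mul_assoc, hA.right, Matrix.mul_one]
  have hcol : ∀ i, colVec (A * V) i = (s i : 𝕜) • colVec U i := by
    intro i
    ext c
    simp [hAV, colVec, RCLike.real_smul_eq_coe_mul, mul_comm]
  have hlast : (fun j => toEuclideanLin F (z (Fin.last n) j)) = colVec (A * V) := by
    funext j
    simp only [hz, toEuclideanLin_colVec, ← Matrix.mul_assoc, h]
  -- The vectors `A v_i = s_i u_i` are already orthogonal, so the final Gram–Schmidt lengths are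
  -- exactly `s i`.
  have hAVgs : gramSchmidt 𝕜 (colVec (A * V)) = colVec (A * V) := by
    refine gramSchmidt_of_orthogonal 𝕜 fun i j hij => ?_
    change inner 𝕜 (colVec (A * V) i) (colVec (A * V) j) = 0
    rw [hcol, hcol, inner_smul_left, inner_smul_right, inner_colVec, hA.left,
      Matrix.one_apply_ne hij, mul_zero, mul_zero]
  have hs : ∀ i, s i ≤ (∏ l, β l i) * γ i := by
    intro i
    have h1 := norm_gramSchmidt_step F (z (Fin.last n)) i
    rw [hlast, hAVgs, hcol, norm_smul, norm_colVec hA.left, mul_one, RCLike.norm_ofReal,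
      abs_of_nonneg (hA.nonneg i)] at h1
    have h2 := le_mul_prod_of_succ_le (fun l => ‖gramSchmidt 𝕜 (z l) i‖) (fun l => β l i)
      (fun l => norm_nonneg _) (fun l => hstep l i)
    rw [hz0] at h2
    have h3 : ‖z 0 i‖ = 1 := by
      simp only [hz, chain_zero, Matrix.one_mul]
      exact norm_colVec hA.right i
    rw [h3, one_mul] at h2
    exact h1.trans (mul_le_mul_of_nonneg_right h2 (norm_nonneg _))
  have hi : ∀ i, ((n + 1 : ℕ) : ℝ) * s i ^ (2 / ((n + 1 : ℕ) : ℝ))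
      ≤ (∑ l, β l i ^ 2) + γ i ^ 2 := by
    intro i
    have := card_mul_prod_rpow_le_sum n.succ_pos
      (Fin.snoc (α := fun _ => ℝ) (fun l => β l i) (γ i)) (by
        intro j
        refine Fin.lastCases ?_ (fun j => ?_) j
        · simp [hγ]
        · simp [hβ])
    simp only [Fin.prod_univ_castSucc, Fin.sum_univ_castSucc, Fin.snoc_castSucc,
      Fin.snoc_last] at this
    refine le_trans ?_ this
    gcongr
    · exact hA.nonneg i
    · exact hs i
  rw [Finset.mul_sum]
  calc _ ≤ ∑ i, ((∑ l, β l i ^ 2) + γ i ^ 2) := Finset.sum_le_sum fun i _ => hi i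
    _ = (∑ l, ∑ i, β l i ^ 2) + ∑ i, γ i ^ 2 := by
      rw [Finset.sum_add_distrib, Finset.sum_comm]
    _ ≤ _ := add_le_add
      (Finset.sum_le_sum fun l _ => sum_norm_map_gramSchmidtNormed_le _ _)
      (sum_norm_map_gramSchmidtNormed_le _ _)

/-- The inclusion of the first `r` coordinates. -/
def inclusionMatrix (𝕜 : Type) [RCLike 𝕜] (a r : ℕ) : Matrix (Fin a) (Fin r) 𝕜 :=
  Matrix.of fun c i => if (c : ℕ) = i then 1 else 0

theorem inclusionMatrix_conjTranspose_mul_self {a r : ℕ} (h : r ≤ a) :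
    (inclusionMatrix 𝕜 a r)ᴴ * inclusionMatrix 𝕜 a r = 1 := by
  ext i j
  simp only [inclusionMatrix, Matrix.mul_apply, Matrix.conjTranspose_apply, Matrix.of_apply]
  rw [Finset.sum_eq_single (Fin.castLE h i)]
  · by_cases hij : i = j
    · subst hij; simp
    · have : (i : ℕ) ≠ j := fun h => hij (Fin.ext h)
      simp [this, Matrix.one_apply_ne hij]
  · intro c _ hc
    have : (c : ℕ) ≠ i := fun h => hc (Fin.ext (by simpa using h))
    simp [this]
  · simp

theorem frobSq_mul_diagonal_mul {a b : ℕ} {P : Matrix (Fin a) (Fin r) 𝕜}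
    {Q : Matrix (Fin b) (Fin r) 𝕜} (hP : Pᴴ * P = 1) (hQ : Qᴴ * Q = 1) (t : Fin r → ℝ) :
    frobSq (P * Matrix.diagonal (fun i => (t i : 𝕜)) * Qᴴ) = ∑ i, t i ^ 2 := by
  have h : ((frobSq (P * Matrix.diagonal (fun i => (t i : 𝕜)) * Qᴴ) : ℝ) : 𝕜)
      = ((∑ i, t i ^ 2 : ℝ) : 𝕜) := by
    rw [frobSq_eq_trace]
    set D := Matrix.diagonal (fun i => (t i : 𝕜)) with hD
    have hDs : Dᴴ = D := by
      rw [hD, Matrix.diagonal_conjTranspose]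
      congr 1
      funext i
      simp
    have : P * D * Qᴴ * (P * D * Qᴴ)ᴴ = P * (D * D * Pᴴ) := by
      simp only [Matrix.conjTranspose_mul, Matrix.conjTranspose_conjTranspose, hDs]
      calc _ = P * D * (Qᴴ * Q) * D * Pᴴ := by simp only [Matrix.mul_assoc]
        _ = _ := by rw [hQ, Matrix.mul_one]; simp only [Matrix.mul_assoc]
    rw [this, Matrix.trace_mul_comm, Matrix.mul_assoc, hP, Matrix.mul_one, hD,
      Matrix.diagonal_mul_diagonal, Matrix.trace_diagonal]
    push_cast
    exact Finset.sum_congr rfl fun i _ => by ring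
  exact_mod_cast h

/-- Spreading the singular values evenly over the layers is the equality case of AM–GM. -/
theorem IsThinSVD.exists_chain {A : Matrix (Fin K) (Fin (C 0)) 𝕜} {U : Matrix (Fin K) (Fin r) 𝕜}
    {s : Fin r → ℝ} {V : Matrix (Fin (C 0)) (Fin r) 𝕜} (hA : IsThinSVD A U s V)
    (hr : ∀ l, r ≤ C l) :
    ∃ (M : ∀ l : Fin n, Matrix (Fin (C l.succ)) (Fin (C l.castSucc)) 𝕜)
      (F : Matrix (Fin K) (Fin (C (Fin.last n))) 𝕜), F * chain M (Fin.last n) = A ∧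
      (∑ l, frobSq (M l)) + frobSq F
        = ((n + 1 : ℕ) : ℝ) * ∑ i, s i ^ (2 / ((n + 1 : ℕ) : ℝ)) := by
  set t : Fin r → ℝ := fun i => s i ^ (1 / ((n + 1 : ℕ) : ℝ)) with ht
  have hn : ((n + 1 : ℕ) : ℝ) ≠ 0 := by positivity
  have ht2 : ∀ i, t i ^ 2 = s i ^ (2 / ((n + 1 : ℕ) : ℝ)) := by
    intro i
    rw [ht, ← Real.rpow_natCast, ← Real.rpow_mul (hA.nonneg i)]
    congr 1
    push_cast
    ring
  have htn : ∀ i, t i ^ (n + 1) = s i := by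
    intro i
    rw [ht, ← Real.rpow_natCast, ← Real.rpow_mul (hA.nonneg i), one_div, inv_mul_cancel₀ hn,
      Real.rpow_one]
  set D : Matrix (Fin r) (Fin r) 𝕜 := Matrix.diagonal (fun i => (t i : 𝕜)) with hD
  -- Only `Q 0 = V` is forced; at the hidden widths any isometry works, and `r ≤ C l` provides one.
  let Q : ∀ l : Fin (n + 1), Matrix (Fin (C l)) (Fin r) 𝕜 :=
    fun l => Fin.cases (motive := fun l => Matrix (Fin (C l)) (Fin r) 𝕜) V
      (fun l => inclusionMatrix 𝕜 (C l.succ) r) l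
  have hQ0 : Q 0 = V := rfl
  have hQ : ∀ l, (Q l)ᴴ * Q l = 1 := by
    intro l
    refine Fin.cases ?_ (fun l => ?_) l
    · exact hA.right
    · exact inclusionMatrix_conjTranspose_mul_self (hr _)
  refine ⟨fun l => Q l.succ * D * (Q l.castSucc)ᴴ, U * D * (Q (Fin.last n))ᴴ, ?_, ?_⟩
  · have key : ∀ l : Fin (n + 1), (Q l)ᴴ *
        chain (fun l => Q l.succ * D * (Q l.castSucc)ᴴ) l = D ^ (l : ℕ) * Vᴴ := by
      intro l
      induction l using Fin.induction with
      | zero => simp [chain_zero, hQ0]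
      | succ l ih =>
        rw [chain_succ]
        calc _ = ((Q l.succ)ᴴ * Q l.succ) * D * ((Q l.castSucc)ᴴ *
              chain (fun l => Q l.succ * D * (Q l.castSucc)ᴴ) l.castSucc) := by
              simp only [Matrix.mul_assoc]
          _ = _ := by
            rw [hQ, ih, Matrix.one_mul, ← Matrix.mul_assoc, Fin.val_castSucc, Fin.val_succ,
              pow_succ']
    rw [Matrix.mul_assoc, key, ← Matrix.mul_assoc, Matrix.mul_assoc U, Fin.val_last,
      ← pow_succ', hD, Matrix.diagonal_pow, hA.eq]
    congr 3
    funext i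
    rw [Pi.pow_apply, ← htn i]
    push_cast
    rfl
  · rw [frobSq_mul_diagonal_mul hA.left (hQ _)]
    simp only [hD, frobSq_mul_diagonal_mul (hQ _) (hQ _), ht2]
    simp
    ring

end Chain

/-! ### Singular value decomposition over ℝ and ℂ -/

section SVD

variable {𝕜 : Type} [RCLike 𝕜] {a b r : ℕ}

theorem finrank_range_toEuclideanLin (A : Matrix (Fin a) (Fin b) 𝕜) :
    Module.finrank 𝕜 (toEuclideanLin A).range = A.rank :=
  (Matrix.rank_eq_finrank_range_toLin A (PiLp.basisFun 2 𝕜 (Fin a))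
    (PiLp.basisFun 2 𝕜 (Fin b))).symm

/-- Right singular vectors are eigenvectors of `T* T`; their normalized nonzero images are
orthonormal and extend to a basis of left singular vectors. The rank bound makes all singular values
from index `r` on vanish. -/
theorem exists_isThinSVD (A : Matrix (Fin a) (Fin b) 𝕜) (hA : A.rank ≤ r) (ha : r ≤ a)
    (hb : r ≤ b) :
    ∃ U V, IsThinSVD A U (fun i : Fin r => (toEuclideanLin A).singularValues i) V := by
  set T := toEuclideanLin A with hTdef
  have hn : Module.finrank 𝕜 (EuclideanSpace 𝕜 (Fin b)) = b := by simp
  set e := T.isSymmetric_adjoint_comp_self.eigenvectorBasis hn with he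
  have hin : ∀ i j, inner 𝕜 (T (e i)) (T (e j))
      = if i = j then ((T.singularValues j : ℝ) : 𝕜) ^ 2 else 0 := by
    intro i j
    rw [← LinearMap.adjoint_inner_right, ← LinearMap.comp_apply, he,
      LinearMap.IsSymmetric.apply_eigenvectorBasis, ← he, inner_smul_right,
      ← T.sq_singularValues_fin hn, OrthonormalBasis.inner_eq_ite]
    split_ifs <;> simp
  have hzero : ∀ j : Fin b, T.singularValues j = 0 → T (e j) = 0 := by
    intro j hj
    have := hin j j
    rw [if_pos rfl, hj] at this
    simpa using this
  have hge : ∀ j : ℕ, r ≤ j → T.singularValues j = 0 := by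
    intro j hj
    rw [LinearMap.singularValues_eq_zero_iff_le_finrank_range, hTdef,
      finrank_range_toEuclideanLin]
    exact hA.trans hj
  -- The value 0 for `b ≤ c` is harmless: `v` is only used on `S`, whose indices are below `b`.
  let v : Fin a → EuclideanSpace 𝕜 (Fin a) := fun c =>
    if h : (c : ℕ) < b then ((T.singularValues c : ℝ) : 𝕜)⁻¹ • T (e ⟨c, h⟩) else 0
  let S : Set (Fin a) := {c | T.singularValues c ≠ 0}
  have hlt : ∀ c ∈ S, (c : ℕ) < b := by
    intro c hc
    by_contra h
    exact hc (T.singularValues_of_finrank_le (by simpa using h))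
  have hv : Orthonormal 𝕜 (S.domRestrict v) := by
    classical
    rw [orthonormal_iff_ite]
    rintro ⟨i, hi⟩ ⟨j, hj⟩
    have hj' : ((T.singularValues j : ℝ) : 𝕜) ≠ 0 := by exact_mod_cast hj
    simp only [Set.domRestrict_apply, v, dif_pos (hlt i hi), dif_pos (hlt j hj), inner_smul_left,
      inner_smul_right, hin, Subtype.mk.injEq, Fin.ext_iff]
    split_ifs with h
    · rw [h]
      simp only [map_inv₀, RCLike.conj_ofReal]
      field_simp
    · simp
  obtain ⟨f, hf⟩ := hv.exists_orthonormalBasis_extension_of_card_eq (by simp)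
  have hTe : ∀ (j : Fin b) (h : (j : ℕ) < a),
      T (e j) = ((T.singularValues j : ℝ) : 𝕜) • f ⟨j, h⟩ := by
    intro j h
    by_cases hj : T.singularValues j = 0
    · rw [hzero j hj, hj]; simp
    · have hj' : ((T.singularValues j : ℝ) : 𝕜) ≠ 0 := by exact_mod_cast hj
      rw [hf ⟨j, h⟩ hj]
      simp only [v, dif_pos j.2]
      rw [smul_smul, mul_inv_cancel₀ hj', one_smul]
  refine ⟨Matrix.of fun c i => f (Fin.castLE ha i) c, Matrix.of fun c i => e (Fin.castLE hb i) c,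
    fun i => T.singularValues_nonneg i, ?_, ?_, ?_⟩
  · ext i j
    rw [← inner_colVec]
    change inner 𝕜 (f (Fin.castLE ha i)) (f (Fin.castLE ha j)) = _
    rw [OrthonormalBasis.inner_eq_ite, Matrix.one_apply]
    simp
  · ext i j
    rw [← inner_colVec]
    change inner 𝕜 (e (Fin.castLE hb i)) (e (Fin.castLE hb j)) = _
    rw [OrthonormalBasis.inner_eq_ite, Matrix.one_apply]
    simp
  · set U : Matrix (Fin a) (Fin r) 𝕜 := Matrix.of fun c i => f (Fin.castLE ha i) c
    set V : Matrix (Fin b) (Fin r) 𝕜 := Matrix.of fun c i => e (Fin.castLE hb i) c with hV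
    have hVe : ∀ i j, (Vᴴ *ᵥ (e j).ofLp) i = if Fin.castLE hb i = j then 1 else 0 := by
      intro i j
      rw [← e.inner_eq_ite]
      simp [hV, Matrix.mulVec, dotProduct, PiLp.inner_apply, mul_comm]
    apply (toEuclideanLin (𝕜 := 𝕜) (m := Fin a) (n := Fin b)).injective
    refine e.toBasis.ext fun j => ?_
    rw [OrthonormalBasis.coe_toBasis]
    change T (e j) = _
    ext c
    simp only [Matrix.ofLp_toLpLin, Matrix.toLin'_apply, ← Matrix.mulVec_mulVec]
    have h2 : (U *ᵥ ((Matrix.diagonal fun i : Fin r => ((T.singularValues i : ℝ) : 𝕜)) *ᵥ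
        (Vᴴ *ᵥ (e j).ofLp))) c = ∑ i, f (Fin.castLE ha i) c *
          (((T.singularValues i : ℝ) : 𝕜) * if Fin.castLE hb i = j then 1 else 0) := by
      simp only [← hVe]
      change ∑ i, U c i * ((Matrix.diagonal fun i : Fin r => ((T.singularValues i : ℝ) : 𝕜)) *ᵥ
        (Vᴴ *ᵥ (e j).ofLp)) i = _
      exact Finset.sum_congr rfl fun i _ => by rw [Matrix.mulVec_diagonal]; rfl
    rw [h2]
    by_cases hj : (j : ℕ) < r
    · rw [Finset.sum_eq_single ⟨j, hj⟩, hTe j (hj.trans_le ha)]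
      · simp [mul_comm, RCLike.real_smul_eq_coe_mul]
      · intro i _ hi
        rw [if_neg, mul_zero, mul_zero]
        exact fun h => hi (Fin.ext (by simpa using congrArg Fin.val h))
      · simp
    · rw [hzero j (hge j (not_lt.1 hj)), Finset.sum_eq_zero]
      · simp
      · intro i _
        rw [if_neg, mul_zero, mul_zero]
        rintro rfl
        exact hj (by simp)

theorem schatten_rpow {p : ℝ} (hp : 0 < p) (A : Matrix (Fin a) (Fin b) ℂ) (hA : A.rank ≤ r)
    (ha : r ≤ a) (hb : r ≤ b) :
    schatten p A ^ p = ∑ i : Fin r, (toEuclideanLin A).singularValues i ^ p := by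
  rw [schatten, ← Real.rpow_mul (Finset.sum_nonneg fun i _ =>
    Real.rpow_nonneg (LinearMap.singularValues_nonneg _ i) _), one_div, inv_mul_cancel₀ hp.ne',
    Real.rpow_one, Fin.sum_univ_eq_sum_range
      (fun i => (toEuclideanLin A).singularValues i ^ p)]
  symm
  refine Finset.sum_subset (Finset.range_mono (le_min ha hb)) fun i _ hi => ?_
  have : (toEuclideanLin A).singularValues i = 0 := by
    rw [LinearMap.singularValues_eq_zero_iff_le_finrank_range, finrank_range_toEuclideanLin]
    exact hA.trans (by simpa using hi)
  rw [this, Real.zero_rpow hp.ne']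

theorem linearIndependent_ofReal {ι κ : Type} [Fintype ι] {f : ι → κ → ℝ}
    (hf : LinearIndependent ℝ f) : LinearIndependent ℂ (fun i c => (f i c : ℂ)) := by
  rw [Fintype.linearIndependent_iff] at hf ⊢
  intro g hg i
  have h : ∀ c, ∑ j, g j * (f j c : ℂ) = 0 := fun c => by simpa using congrFun hg c
  have hre := hf (fun j => (g j).re) (by
    funext c
    simpa using congrArg Complex.re (h c)) i
  have him := hf (fun j => (g j).im) (by
    funext c
    simpa using congrArg Complex.im (h c)) i
  exact Complex.ext hre him

/-- A real basis chosen among the columns stays independent over ℂ. This lets a real SVD have as few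
terms as the complex rank permits. -/
theorem rank_le_rank_map_ofReal (B : Matrix (Fin a) (Fin b) ℝ) :
    B.rank ≤ (B.map ((↑) : ℝ → ℂ)).rank := by
  rw [Matrix.rank_eq_finrank_span_cols, Matrix.rank_eq_finrank_span_cols]
  obtain ⟨f, hf, -, hli⟩ := Submodule.exists_fun_fin_finrank_span_eq ℝ (Set.range B.col)
  have h := linearIndependent_ofReal hli
  rw [← Fintype.card_fin (Module.finrank ℝ (Submodule.span ℝ (Set.range B.col))),
    ← finrank_span_eq_card h]
  refine Submodule.finrank_mono (Submodule.span_mono ?_)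
  rintro _ ⟨i, rfl⟩
  obtain ⟨j, hj⟩ := hf i
  exact ⟨j, by funext c; simp only [← hj]; rfl⟩

theorem IsThinSVD.map {B : Matrix (Fin a) (Fin b) 𝕜} {U : Matrix (Fin a) (Fin r) 𝕜}
    {s : Fin r → ℝ} {V : Matrix (Fin b) (Fin r) 𝕜} (h : IsThinSVD B U s V) (φ : 𝕜 →+* ℂ)
    (hstar : ∀ x, φ (star x) = star (φ x)) (hreal : ∀ x : ℝ, φ (x : 𝕜) = x) :
    IsThinSVD (B.map φ) (U.map φ) s (V.map φ) := by
  have hconj : ∀ {x y : ℕ} (X : Matrix (Fin x) (Fin y) 𝕜), (X.map φ)ᴴ = Xᴴ.map φ := by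
    intro x y X
    ext i j
    simp [-RCLike.star_def, hstar]
  have hone : (1 : Matrix (Fin r) (Fin r) 𝕜).map φ = 1 :=
    Matrix.map_one _ (map_zero φ) (map_one φ)
  refine ⟨h.nonneg, ?_, ?_, ?_⟩
  · rw [hconj, ← Matrix.map_mul, h.left, hone]
  · rw [hconj, ← Matrix.map_mul, h.right, hone]
  · conv_lhs => rw [h.eq, Matrix.map_mul, Matrix.map_mul]
    rw [hconj, Matrix.diagonal_map (map_zero φ)]
    simp only [hreal]
    rfl

end SVD

/-! ### Optimal cost as a Schatten quasi-norm -/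

section Schatten

variable {n K r : ℕ} {C : Fin (n + 1) → ℕ}

theorem chain_map {𝕜 : Type} [RCLike 𝕜] (φ : 𝕜 →+* ℂ)
    (M : ∀ l : Fin n, Matrix (Fin (C l.succ)) (Fin (C l.castSucc)) 𝕜) (l : Fin (n + 1)) :
    chain (fun l => (M l).map φ) l = (chain M l).map φ := by
  induction l using Fin.induction with
  | zero => exact (Matrix.map_one _ (map_zero φ) (map_one φ)).symm
  | succ l ih => rw [chain_succ, chain_succ, ih, Matrix.map_mul]

theorem frobSq_map {𝕜 : Type} [RCLike 𝕜] {a b : ℕ} (φ : 𝕜 →+* ℂ) (hφ : ∀ x, ‖φ x‖ = ‖x‖)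
    (A : Matrix (Fin a) (Fin b) 𝕜) : frobSq (A.map φ) = frobSq A := by
  simp [frobSq, hφ]

/-- Up to the factor `n + 1`, both sides are the minimal cost of factoring `A`: each SVD gives a
lower bound that the balanced chain of the other must obey. No uniqueness of singular values is
needed. -/
theorem IsThinSVD.sum_rpow_eq_schatten {A : Matrix (Fin K) (Fin (C 0)) ℂ}
    {U : Matrix (Fin K) (Fin r) ℂ} {s : Fin r → ℝ} {V : Matrix (Fin (C 0)) (Fin r) ℂ}
    (h : IsThinSVD A U s V) (hA : A.rank ≤ r) (hC : ∀ l, r ≤ C l) (hK : r ≤ K) :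
    ∑ i, s i ^ (2 / ((n + 1 : ℕ) : ℝ))
      = schatten (2 / ((n + 1 : ℕ) : ℝ)) A ^ (2 / ((n + 1 : ℕ) : ℝ)) := by
  rw [schatten_rpow (by positivity) A hA hK (hC 0)]
  obtain ⟨U', V', h'⟩ := exists_isThinSVD A hA hK (hC 0)
  have hn : (0 : ℝ) < ((n + 1 : ℕ) : ℝ) := by positivity
  obtain ⟨M, F, hM, hc⟩ := h.exists_chain hC
  obtain ⟨M', F', hM', hc'⟩ := h'.exists_chain hC
  apply le_antisymm
  · exact le_of_mul_le_mul_left ((h.le_of_chain M' F' hM').trans hc'.le) hn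
  · exact le_of_mul_le_mul_left ((h'.le_of_chain M F hM).trans hc.le) hn

theorem schatten_le_of_chain (A : Matrix (Fin K) (Fin (C 0)) ℂ)
    (hA : A.rank ≤ r) (hC : ∀ l, r ≤ C l) (hK : r ≤ K)
    (M : ∀ l : Fin n, Matrix (Fin (C l.succ)) (Fin (C l.castSucc)) ℂ)
    (F : Matrix (Fin K) (Fin (C (Fin.last n))) ℂ) (h : F * chain M (Fin.last n) = A) :
    ((n + 1 : ℕ) : ℝ) * schatten (2 / ((n + 1 : ℕ) : ℝ)) A ^ (2 / ((n + 1 : ℕ) : ℝ))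
      ≤ (∑ l, frobSq (M l)) + frobSq F := by
  obtain ⟨U, V, hS⟩ := exists_isThinSVD A hA hK (hC 0)
  rw [← hS.sum_rpow_eq_schatten hA hC hK]
  exact hS.le_of_chain M F h

theorem exists_chain_schatten (A : Matrix (Fin K) (Fin (C 0)) ℂ)
    (hA : A.rank ≤ r) (hC : ∀ l, r ≤ C l) (hK : r ≤ K) :
    ∃ (M : ∀ l : Fin n, Matrix (Fin (C l.succ)) (Fin (C l.castSucc)) ℂ)
      (F : Matrix (Fin K) (Fin (C (Fin.last n))) ℂ), F * chain M (Fin.last n) = A ∧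
      (∑ l, frobSq (M l)) + frobSq F = ((n + 1 : ℕ) : ℝ) *
        schatten (2 / ((n + 1 : ℕ) : ℝ)) A ^ (2 / ((n + 1 : ℕ) : ℝ)) := by
  obtain ⟨U, V, hS⟩ := exists_isThinSVD A hA hK (hC 0)
  rw [← hS.sum_rpow_eq_schatten hA hC hK]
  exact hS.exists_chain hC

/-- Optimal factors of a real matrix can be chosen to be real. -/
theorem exists_real_chain_schatten (B : Matrix (Fin K) (Fin (C 0)) ℝ)
    (hB : (B.map Complex.ofRealHom).rank ≤ r) (hC : ∀ l, r ≤ C l) (hK : r ≤ K) :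
    ∃ (M : ∀ l : Fin n, Matrix (Fin (C l.succ)) (Fin (C l.castSucc)) ℝ)
      (F : Matrix (Fin K) (Fin (C (Fin.last n))) ℝ), F * chain M (Fin.last n) = B ∧
      (∑ l, frobSq (M l)) + frobSq F = ((n + 1 : ℕ) : ℝ) *
        schatten (2 / ((n + 1 : ℕ) : ℝ)) (B.map Complex.ofRealHom)
          ^ (2 / ((n + 1 : ℕ) : ℝ)) := by
  obtain ⟨U, V, hS⟩ := exists_isThinSVD B ((rank_le_rank_map_ofReal B).trans hB) hK (hC 0)
  rw [← (hS.map Complex.ofRealHom (by simp) (by simp)).sum_rpow_eq_schatten hB hC hK]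
  exact hS.exists_chain hC

open scoped ComplexOrder in
theorem rank_map_conj {a b : ℕ} (A : Matrix (Fin a) (Fin b) ℂ) :
    (A.map (starRingEnd ℂ)).rank = A.rank := by
  rw [← Matrix.rank_conjTranspose A, ← Matrix.rank_transpose Aᴴ]
  rfl

theorem schatten_map_conj (A : Matrix (Fin K) (Fin (C 0)) ℂ)
    (hA : A.rank ≤ r) (hC : ∀ l, r ≤ C l) (hK : r ≤ K) :
    schatten (2 / ((n + 1 : ℕ) : ℝ)) (A.map (starRingEnd ℂ)) ^ (2 / ((n + 1 : ℕ) : ℝ))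
      = schatten (2 / ((n + 1 : ℕ) : ℝ)) A ^ (2 / ((n + 1 : ℕ) : ℝ)) := by
  obtain ⟨U, V, hS⟩ := exists_isThinSVD A hA hK (hC 0)
  rw [← hS.sum_rpow_eq_schatten hA hC hK]
  exact ((hS.map (starRingEnd ℂ) (by simp) (by simp)).sum_rpow_eq_schatten
    ((rank_map_conj A).trans_le hA) hC hK).symm

end Schatten

/-! ### Unitary Fourier transform on ℤ/H × ℤ/W -/

section Fourier

variable {H W : ℕ} [NeZero H] [NeZero W]

/-- The kernel of the discrete Fourier transform on the group `ℤ/H × ℤ/W`. -/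
def kernel (p q : ZMod H × ZMod W) : ℂ := dftKernel p.1 q.1 p.2 q.2

/-- The discrete Fourier transform on the group `ℤ/H × ℤ/W`. -/
def fourier (f : ZMod H × ZMod W → ℂ) (q : ZMod H × ZMod W) : ℂ := ∑ p, f p * kernel p q

theorem kernel_comm (p q : ZMod H × ZMod W) : kernel p q = kernel q p := by
  simp [kernel, dftKernel, mul_comm]

theorem kernel_neg_right (p q : ZMod H × ZMod W) : kernel p (-q) = conj (kernel p q) := by
  simp [kernel, dftKernel, AddChar.map_neg_eq_conj]

theorem kernel_neg_left (p q : ZMod H × ZMod W) : kernel (-p) q = conj (kernel p q) := by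
  rw [kernel_comm, kernel_neg_right, kernel_comm]

theorem sqrt_mul_ne_zero (H W : ℕ) [NeZero H] [NeZero W] : √((H : ℝ) * W) ≠ 0 := by
  have hH : (0 : ℝ) < H := by exact_mod_cast NeZero.pos H
  have hW : (0 : ℝ) < W := by exact_mod_cast NeZero.pos W
  positivity

theorem kernel_add (p p' q : ZMod H × ZMod W) :
    kernel (p + p') q = (√((H : ℝ) * W) : ℂ) * (kernel p q * kernel p' q) := by
  have h : (√((H : ℝ) * W) : ℂ) ≠ 0 := by exact_mod_cast sqrt_mul_ne_zero H W
  simp only [kernel, dftKernel, Prod.fst_add, Prod.snd_add, add_mul, neg_add,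
    AddChar.map_add_eq_mul]
  push_cast
  field_simp

theorem sum_kernel_mul_conj (p p' : ZMod H × ZMod W) :
    ∑ q, kernel p q * conj (kernel p' q) = if p = p' then 1 else 0 := by
  have hH : (H : ℂ) ≠ 0 := by exact_mod_cast NeZero.ne H
  have hW : (W : ℂ) ≠ 0 := by exact_mod_cast NeZero.ne W
  have hsq : (√((H : ℝ) * W) : ℂ) * (√((H : ℝ) * W) : ℂ) = (H : ℂ) * W := by
    rw [← Complex.ofReal_mul, Real.mul_self_sqrt (by positivity)]
    push_cast
    rfl
  have hs : (√((H : ℝ) * W) : ℂ) ≠ 0 := by exact_mod_cast sqrt_mul_ne_zero H W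
  have key : ∀ q : ZMod H × ZMod W, kernel p q * conj (kernel p' q) = ((H : ℂ) * W)⁻¹ *
      (ZMod.stdAddChar (q.1 * (p'.1 - p.1)) * ZMod.stdAddChar (q.2 * (p'.2 - p.2))) := by
    intro q
    rw [← kernel_neg_left, ← hsq]
    have e1 : q.1 * (p'.1 - p.1) = -(p.1 * q.1) + -(-p'.1 * q.1) := by ring
    have e2 : q.2 * (p'.2 - p.2) = -(p.2 * q.2) + -(-p'.2 * q.2) := by ring
    rw [e1, e2, AddChar.map_add_eq_mul, AddChar.map_add_eq_mul]
    simp only [kernel, dftKernel, Prod.fst_neg, Prod.snd_neg]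
    push_cast
    field_simp
  simp only [key, ← Finset.mul_sum]
  rw [Fintype.sum_prod_type]
  simp only [← Finset.mul_sum, ← Finset.sum_mul]
  rw [AddChar.sum_mulShift _ (ZMod.isPrimitive_stdAddChar H),
    AddChar.sum_mulShift _ (ZMod.isPrimitive_stdAddChar W)]
  simp only [sub_eq_zero, ZMod.card, Prod.ext_iff, eq_comm (a := p.1), eq_comm (a := p.2)]
  by_cases h1 : p'.1 = p.1 <;> by_cases h2 : p'.2 = p.2 <;>
    simp [h1, h2]
  · field_simp

theorem sum_fourier_mul_conj_kernel (f : ZMod H × ZMod W → ℂ) (p : ZMod H × ZMod W) :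
    ∑ q, fourier f q * conj (kernel p q) = f p := by
  simp only [fourier, Finset.sum_mul, mul_assoc]
  rw [Finset.sum_comm]
  simp [← Finset.mul_sum, sum_kernel_mul_conj]

theorem fourier_injective : Function.Injective (fourier (H := H) (W := W)) := by
  intro f g h
  funext p
  rw [← sum_fourier_mul_conj_kernel f p, h, sum_fourier_mul_conj_kernel]

theorem sum_fourier_mul_conj_fourier (f g : ZMod H × ZMod W → ℂ) :
    ∑ q, fourier f q * conj (fourier g q) = ∑ p, f p * conj (g p) := by
  have h : ∀ q, fourier f q * conj (fourier g q)
      = ∑ p, conj (g p) * (fourier f q * conj (kernel p q)) := by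
    intro q
    rw [fourier.eq_def g, map_sum, Finset.mul_sum]
    exact Finset.sum_congr rfl fun p _ => by rw [map_mul]; ring
  simp only [h]
  rw [Finset.sum_comm]
  simp only [← Finset.mul_sum, sum_fourier_mul_conj_kernel]
  exact Finset.sum_congr rfl fun p _ => mul_comm _ _

theorem sum_norm_fourier_sq (f : ZMod H × ZMod W → ℂ) :
    ∑ q, ‖fourier f q‖ ^ 2 = ∑ p, ‖f p‖ ^ 2 := by
  have h := sum_fourier_mul_conj_fourier f f
  simp only [Complex.mul_conj'] at h
  exact_mod_cast h

theorem fourier_neg (f : ZMod H × ZMod W → ℂ) (q : ZMod H × ZMod W) :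
    fourier (fun p => f (-p)) q = fourier f (-q) := by
  rw [fourier, ← Equiv.sum_comp (Equiv.neg _)]
  simp [fourier, kernel_neg_left, kernel_neg_right]

theorem conj_fourier_ofReal (f : ZMod H × ZMod W → ℝ) (q : ZMod H × ZMod W) :
    conj (fourier (fun p => (f p : ℂ)) q) = fourier (fun p => (f p : ℂ)) (-q) := by
  simp [fourier, kernel_neg_right]

/-- The inverse transform of `g` is real, as the substitution `q ↦ -q` shows. -/
theorem exists_fourier_ofReal_eq (g : ZMod H × ZMod W → ℂ) (hg : ∀ q, g (-q) = conj (g q)) :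
    ∃ f : ZMod H × ZMod W → ℝ, fourier (fun p => (f p : ℂ)) = g := by
  set h : ZMod H × ZMod W → ℂ := fun p => ∑ q, g q * conj (kernel p q) with hh
  have hreal : ∀ p, ((h p).re : ℂ) = h p := by
    intro p
    rw [← Complex.conj_eq_iff_re, hh]
    simp only [map_sum, map_mul, Complex.conj_conj]
    rw [← Equiv.sum_comp (Equiv.neg _)]
    simp [hg, kernel_neg_right]
  refine ⟨fun p => (h p).re, ?_⟩
  simp only [hreal]
  funext q
  simp only [fourier, hh, Finset.sum_mul]
  rw [Finset.sum_comm]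
  have : ∀ q', ∑ p, g q' * conj (kernel p q') * kernel p q = g q' * if q = q' then 1 else 0 := by
    intro q'
    rw [← sum_kernel_mul_conj, Finset.mul_sum]
    exact Finset.sum_congr rfl fun p _ => by
      rw [kernel_comm p q', kernel_comm p q]; ring
  simp [this]

/-- The factor arises because the normalized kernel is multiplicative only up to √(HW). -/
theorem fourier_convolution (f g : ZMod H × ZMod W → ℂ) (q : ZMod H × ZMod W) :
    fourier (fun p => ∑ p', f p' * g (p - p')) q
      = (√((H : ℝ) * W) : ℂ) * (fourier f q * fourier g q) := by
  simp only [fourier, Finset.sum_mul]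
  rw [Finset.sum_comm, Finset.mul_sum]
  refine Finset.sum_congr rfl fun p _ => ?_
  rw [← Equiv.sum_comp (Equiv.addRight p), Finset.mul_sum, Finset.mul_sum]
  refine Finset.sum_congr rfl fun p' _ => ?_
  simp only [Equiv.coe_addRight, add_sub_cancel_right, kernel_add]
  ring

end Fourier

/-! ### Fourier transform of images and tensors -/

section Tensors

variable {H W a b : ℕ} [NeZero H] [NeZero W]

theorem dftImage_eq (x : Image ℝ a H W) (c : Fin a) (i : ZMod H) (j : ZMod W) :
    dftImage x c i j = fourier (fun p => (x c p.1 p.2 : ℂ)) (i, j) := by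
  simp [dftImage, fourier, kernel, Fintype.sum_prod_type]

theorem dftTensor_eq (w : Tensor ℝ a H W b) (c : Fin a) (i : ZMod H) (j : ZMod W) (d : Fin b) :
    dftTensor w c i j d = fourier (fun p => (w c p.1 p.2 d : ℂ)) (i, j) := by
  simp [dftTensor, fourier, kernel, Fintype.sum_prod_type]

theorem exists_dftTensor_iff (v : Tensor ℂ a H W b) :
    (∃ u : Tensor ℝ a H W b, v = dftTensor u) ↔
      ∀ c i j d, v c (-i) (-j) d = conj (v c i j d) := by
  constructor
  · rintro ⟨u, rfl⟩ c i j d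
    rw [dftTensor_eq, dftTensor_eq, conj_fourier_ofReal]
    rfl
  · intro h
    choose u hu using fun c d =>
      exists_fourier_ofReal_eq (fun q : ZMod H × ZMod W => v c q.1 q.2 d) (fun q => h c q.1 q.2 d)
    refine ⟨fun c i j d => u c d (i, j), ?_⟩
    funext c i j d
    rw [dftTensor_eq]
    exact (congrFun (hu c d) (i, j)).symm

theorem sqNorm_eq_sum {R : Type} [Norm R] (w : Tensor R a H W b) :
    sqNorm w = ∑ c, ∑ d, ∑ p : ZMod H × ZMod W, ‖w c p.1 p.2 d‖ ^ 2 := by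
  simp only [sqNorm, Fintype.sum_prod_type]
  exact Finset.sum_congr rfl fun c _ =>
    (Finset.sum_congr rfl fun _ _ => Finset.sum_comm).trans Finset.sum_comm

theorem sqNorm_dftTensor (w : Tensor ℝ a H W b) : sqNorm (dftTensor w) = sqNorm w := by
  simp only [sqNorm_eq_sum, dftTensor_eq, Prod.mk.eta, sum_norm_fourier_sq, Complex.norm_real]

theorem sqNorm_eq_sum_frobSq (w : Tensor ℂ a H W b) :
    sqNorm w = ∑ i, ∑ j, frobSq (block w i j) := by
  simp only [sqNorm, frobSq, block, Matrix.of_apply]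
  rw [Finset.sum_comm]
  exact Finset.sum_congr rfl fun i _ => Finset.sum_comm

theorem contract_eq_sum {R : Type} [CommSemiring R] (w : Tensor R a H W b) (x : Image R b H W)
    (c : Fin a) :
    contract w x c = ∑ d, ∑ p : ZMod H × ZMod W, w c p.1 p.2 d * x d p.1 p.2 := by
  simp only [contract, Fintype.sum_prod_type]
  exact (Finset.sum_congr rfl fun _ _ => Finset.sum_comm).trans Finset.sum_comm

theorem dftImage_conv (w : Tensor ℝ a H W b) (x : Image ℝ b H W) (c : Fin a) (i : ZMod H)
    (j : ZMod W) :
    dftImage (conv w x) c i j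
      = (√((H : ℝ) * W) : ℂ) * pointwise (dftTensor w) (dftImage x) c i j := by
  rw [dftImage_eq, pointwise, Finset.mul_sum]
  simp only [dftTensor_eq, dftImage_eq, ← fourier_convolution]
  simp only [fourier]
  rw [Finset.sum_comm]
  refine Finset.sum_congr rfl fun p _ => ?_
  rw [← Finset.sum_mul]
  congr 1
  simp only [conv, Fintype.sum_prod_type]
  push_cast
  exact (Finset.sum_congr rfl fun _ _ => Finset.sum_comm).trans Finset.sum_comm

/-- Reflection of a tensor in its spatial indices. -/
def reflect {R : Type} (w : Tensor R a H W b) : Tensor R a H W b :=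
  fun c i j d => w c (-i) (-j) d

omit [NeZero H] [NeZero W] in
theorem reflect_reflect {R : Type} (w : Tensor R a H W b) : reflect (reflect w) = w := by
  funext c i j d
  simp [reflect]

theorem sqNorm_reflect {R : Type} [Norm R] (w : Tensor R a H W b) :
    sqNorm (reflect w) = sqNorm w := by
  simp only [sqNorm_eq_sum, reflect]
  refine Finset.sum_congr rfl fun c _ => Finset.sum_congr rfl fun d _ => ?_
  exact Equiv.sum_comp (Equiv.neg (ZMod H × ZMod W)) (fun p => ‖w c p.1 p.2 d‖ ^ 2)

theorem sqNorm_smul (t : ℝ) (w : Tensor ℝ a H W b) : sqNorm (t • w) = t ^ 2 * sqNorm w := by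
  simp [sqNorm, Finset.mul_sum, mul_pow]

theorem dftTensor_smul (t : ℝ) (w : Tensor ℝ a H W b) :
    dftTensor (t • w) = (t : ℂ) • dftTensor w := by
  funext c i j d
  simp [dftTensor, Finset.mul_sum, mul_assoc]

/-- Parseval conjugates the transform of the weights, whereas `contract` is bilinear; for real
weights, conjugation in frequency is reflection in space. -/
theorem contract_dft_reflect (w : Tensor ℝ a H W b) (x : Image ℝ b H W) (c : Fin a) :
    contract (dftTensor (reflect w)) (dftImage x) c = ((contract w x c : ℝ) : ℂ) := by
  rw [contract_eq_sum, contract_eq_sum]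
  push_cast
  refine Finset.sum_congr rfl fun d _ => ?_
  have h := sum_fourier_mul_conj_fourier (fun p : ZMod H × ZMod W => (x d p.1 p.2 : ℂ))
    (fun p => (w c p.1 p.2 d : ℂ))
  simp only [Complex.conj_ofReal] at h
  simp only [mul_comm (w c _ _ d : ℂ)]
  rw [← h]
  refine Finset.sum_congr rfl fun q _ => ?_
  rw [dftTensor_eq, dftImage_eq, conj_fourier_ofReal, ← fourier_neg, mul_comm]
  rfl

theorem contract_im_eq_zero (v : Tensor ℂ a H W b) (hv : ∃ u : Tensor ℝ a H W b, v = dftTensor u)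
    (x : Image ℝ b H W) (c : Fin a) : (contract v (dftImage x) c).im = 0 := by
  obtain ⟨u, rfl⟩ := hv
  rw [← reflect_reflect u, contract_dft_reflect, Complex.ofReal_im]

/-- Real point images suffice: contracting with their transforms evaluates the Fourier transform of
`v`, which is injective. -/
theorem eq_of_contract_dftImage_eq {v v' : Tensor ℂ a H W b}
    (h : ∀ x : Image ℝ b H W, contract v (dftImage x) = contract v' (dftImage x)) : v = v' := by
  have key : ∀ (v : Tensor ℂ a H W b) c d (p : ZMod H × ZMod W),
      contract v (dftImage fun d' i j => if d' = d ∧ (i, j) = p then 1 else 0) c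
        = fourier (fun q => v c q.1 q.2 d) p := by
    intro v c d p
    rw [contract_eq_sum, Finset.sum_eq_single d]
    · refine Finset.sum_congr rfl fun q _ => ?_
      rw [dftImage_eq, fourier, Finset.sum_eq_single p]
      · simp [kernel_comm]
      · intro p' _ hp'
        simp [hp']
      · simp
    · intro d' _ hd'
      refine Finset.sum_eq_zero fun q _ => ?_
      rw [dftImage_eq, fourier, Finset.sum_eq_zero, mul_zero]
      intro p' _
      simp [hd']
    · simp
  funext c i j d
  have : fourier (fun q : ZMod H × ZMod W => v c q.1 q.2 d)
      = fourier (fun q : ZMod H × ZMod W => v' c q.1 q.2 d) := by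
    funext p
    rw [← key, ← key, h]
  exact congrFun (fourier_injective this) (i, j)

end Tensors

/-! ### Abstract equivalence of minimization problems -/

section Minimization

theorem EquivalentMinimization.of_isLeast {α β : Type} {J : α → ℝ} {S : Set β} {J' : β → ℝ}
    {Rep : α → β → Prop} (h : ∀ a, ∃! b, b ∈ S ∧ Rep a b)
    (hmin : ∀ b ∈ S, IsLeast (J '' {a | Rep a b}) (J' b)) :
    EquivalentMinimization J S J' Rep := by
  have hle : ∀ a, ∃ b ∈ S, Rep a b ∧ J' b ≤ J a := fun a => by
    obtain ⟨b, ⟨hb, hab⟩, -⟩ := h a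
    exact ⟨b, hb, hab, (hmin b hb).2 ⟨a, hab, rfl⟩⟩
  have hex : ∀ b ∈ S, ∃ a, Rep a b ∧ J a = J' b := fun b hb => (hmin b hb).1
  refine ⟨h, hmin, le_antisymm ?_ ?_, fun m => ⟨?_, ?_⟩, ?_, ?_⟩
  · refine le_iInf₂ fun b hb => ?_
    obtain ⟨a, -, ha⟩ := hex b hb
    exact (iInf_le _ a).trans (by rw [ha])
  · refine le_iInf fun a => ?_
    obtain ⟨b, hb, -, hab⟩ := hle a
    exact (iInf₂_le b hb).trans (by exact_mod_cast hab)
  · rintro ⟨⟨a, rfl⟩, hm⟩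
    have hlow : J a ∈ lowerBounds (J' '' S) := by
      rintro _ ⟨b, hb, rfl⟩
      obtain ⟨a', -, ha'⟩ := hex b hb
      exact hm ⟨a', ha'⟩
    obtain ⟨b, hb, -, hab⟩ := hle a
    exact ⟨⟨b, hb, le_antisymm hab (hlow ⟨b, hb, rfl⟩)⟩, hlow⟩
  · rintro ⟨⟨b, hb, rfl⟩, hm⟩
    obtain ⟨a, -, ha⟩ := hex b hb
    refine ⟨⟨a, ha⟩, ?_⟩
    rintro _ ⟨a', rfl⟩
    obtain ⟨b', hb', -, hab'⟩ := hle a'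
    exact (hm ⟨b', hb', rfl⟩).trans hab'
  · intro a ha b hb hab b' hb'
    obtain ⟨a', -, ha'⟩ := hex b' hb'
    exact ((hmin b hb).2 ⟨a, hab, rfl⟩).trans ((ha (Set.mem_univ a')).trans ha'.le)
  · intro b hb hbmin
    obtain ⟨a, hab, ha⟩ := hex b hb
    refine ⟨a, hab, fun a' _ => ?_⟩
    obtain ⟨b', hb', -, hab'⟩ := hle a'
    exact ha.le.trans ((hbmin hb').trans hab')

theorem EquivalentMinimization.comp {α α' β : Type} {J : α → ℝ} {S : Set β} {J' : β → ℝ}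
    {Rep : α → β → Prop} (h : EquivalentMinimization J S J' Rep) {Φ : α' → α}
    (hΦ : Function.Surjective Φ) :
    EquivalentMinimization (fun a => J (Φ a)) S J' (fun a b => Rep (Φ a) b) := by
  refine .of_isLeast (fun a => h.existsUnique (Φ a)) fun b hb => ?_
  convert h.isLeast_fiber b hb using 1
  ext x
  constructor
  · rintro ⟨a, ha, rfl⟩
    exact ⟨Φ a, ha, rfl⟩
  · rintro ⟨a, ha, rfl⟩
    obtain ⟨a, rfl⟩ := hΦ a
    exact ⟨a, ha, rfl⟩

end Minimization

/-- On a two-point orbit the point with smaller code gets a free choice and the other its image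
under `τ`; at a fixed point of `σ` the value must be fixed by `τ`. -/
theorem exists_equivariant_choice {α β : Type} [Countable α] {σ : α → α} {τ : β → β}
    (hσ : Function.Involutive σ) (hτ : Function.Involutive τ) {P : α → β → Prop}
    (hP : ∀ a b, P a b → P (σ a) (τ b)) (hex : ∀ a, ∃ b, P a b)
    (hfix : ∀ a, σ a = a → ∃ b, P a b ∧ τ b = b) :
    ∃ f : α → β, ∀ a, P a (f a) ∧ f (σ a) = τ (f a) := by
  classical
  obtain ⟨e, he⟩ := exists_injective_nat α
  choose g hg using hex
  choose k hk hkτ using hfix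
  refine ⟨fun a => if h : σ a = a then k a h else if e a < e (σ a) then g a else τ (g (σ a)),
    fun a => ?_⟩
  by_cases h : σ a = a
  · have h' : σ (σ a) = σ a := congrArg σ h
    simp only [dif_pos h, dif_pos h', hkτ]
    have hcongr : ∀ a' (ha : a' = a) (h1 : σ a' = a'), k a' h1 = k a h := by
      rintro _ rfl _
      rfl
    exact ⟨hk a h, hcongr _ h _⟩
  · have h' : ¬a = σ a := fun h' => h h'.symm
    have hne : e a ≠ e (σ a) := fun h' => h (he h').symm
    simp only [dif_neg h, hσ a, dif_neg h']
    rcases hne.lt_or_gt with hlt | hlt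
    · simp only [if_pos hlt, if_neg hlt.not_gt]
      exact ⟨hg a, trivial⟩
    · simp only [if_pos hlt, if_neg hlt.not_gt, hτ _]
      refine ⟨?_, trivial⟩
      have := hP _ _ (hg (σ a))
      rwa [hσ a] at this

/-! ### The networks -/

section Network

variable {n K H W : ℕ} [NeZero H] [NeZero W] {C : Fin (n + 1) → ℕ}

/-- The tensor that represents the frequency space network. -/
def Weights.endToEnd (w : Weights ℂ C K H W) : Tensor ℂ K H W (C 0) := fun c i j d =>
  (block w.final i j * chain (fun l => block (w.layer l) i j) (Fin.last n)) c d

omit [NeZero H] [NeZero W] in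
theorem Weights.block_endToEnd (w : Weights ℂ C K H W) (i : ZMod H) (j : ZMod W) :
    block w.endToEnd i j
      = block w.final i j * chain (fun l => block (w.layer l) i j) (Fin.last n) := rfl

/-- The output of the first `l` layers of the frequency space network. -/
def Weights.freqHidden (w : Weights ℂ C K H W) (x : Image ℂ (C 0) H W) (l : Fin (n + 1)) :
    Image ℂ (C l) H W :=
  Fin.induction (motive := fun l => Image ℂ (C l) H W) x
    (fun l z => pointwise (w.layer l) z) l

/-- The output of the first `l` layers of the convolutional network. -/
def Weights.hidden (w : Weights ℝ C K H W) (x : Image ℝ (C 0) H W) (l : Fin (n + 1)) :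
    Image ℝ (C l) H W :=
  Fin.induction (motive := fun l => Image ℝ (C l) H W) x
    (fun l z => conv (w.layer l) z) l

omit [NeZero H] [NeZero W] in
theorem Weights.freqHidden_succ (w : Weights ℂ C K H W) (x : Image ℂ (C 0) H W) (l : Fin n) :
    w.freqHidden x l.succ = pointwise (w.layer l) (w.freqHidden x l.castSucc) := by
  simp [freqHidden]

theorem Weights.hidden_succ (w : Weights ℝ C K H W) (x : Image ℝ (C 0) H W) (l : Fin n) :
    w.hidden x l.succ = conv (w.layer l) (w.hidden x l.castSucc) := by
  simp [hidden]

omit [NeZero H] [NeZero W] in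
theorem Weights.freqHidden_eq_mulVec (w : Weights ℂ C K H W) (x : Image ℂ (C 0) H W)
    (l : Fin (n + 1)) (i : ZMod H) (j : ZMod W) :
    (fun c => w.freqHidden x l c i j)
      = chain (fun l => block (w.layer l) i j) l *ᵥ fun d => x d i j := by
  induction l using Fin.induction with
  | zero => rw [chain_zero, Matrix.one_mulVec]; rfl
  | succ l ih =>
    rw [chain_succ, ← Matrix.mulVec_mulVec, ← ih, freqHidden_succ]
    rfl

theorem Weights.freqNet_eq_contract (w : Weights ℂ C K H W) (x : Image ℂ (C 0) H W) :
    w.freqNet x = contract w.endToEnd x := by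
  funext c
  change ∑ i, ∑ j, ∑ d, w.final c i j d * w.freqHidden x (Fin.last n) d i j = _
  refine Finset.sum_congr rfl fun i _ => Finset.sum_congr rfl fun j _ => ?_
  have h : (block w.final i j *ᵥ fun d => w.freqHidden x (Fin.last n) d i j) c
      = (block w.endToEnd i j *ᵥ fun d => x d i j) c := by
    rw [freqHidden_eq_mulVec, Matrix.mulVec_mulVec, block_endToEnd]
  exact h

theorem Weights.sqNormSum_eq_sum (w : Weights ℂ C K H W) :
    w.sqNormSum = ∑ i, ∑ j,
      ((∑ l, frobSq (block (w.layer l) i j)) + frobSq (block w.final i j)) := by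
  simp only [sqNormSum, sqNorm_eq_sum_frobSq, Finset.sum_add_distrib]
  congr 1
  rw [Finset.sum_comm]
  exact Finset.sum_congr rfl fun i _ => Finset.sum_comm

theorem Weights.sqNormSum_dft (w : Weights ℝ C K H W) : w.dft.sqNormSum = w.sqNormSum := by
  simp [sqNormSum, dft, sqNorm_dftTensor]

omit [NeZero H] [NeZero W] in
theorem rank_block_endToEnd_le (w : Weights ℂ C K H W) (i : ZMod H) (j : ZMod W) :
    (block w.endToEnd i j).rank ≤ min (⨅ l, C l) K := by
  rw [w.block_endToEnd]
  refine le_min (le_ciInf fun l => ?_) ?_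
  · exact (Matrix.rank_mul_le_right _ _).trans (rank_chain_le _ _ l (Fin.le_last l))
  · exact (Matrix.rank_mul_le_left _ _).trans (by simpa using Matrix.rank_le_height _)

theorem block_neg {a b : ℕ} {v : Tensor ℂ a H W b} (hv : ∃ u : Tensor ℝ a H W b, v = dftTensor u)
    (i : ZMod H) (j : ZMod W) : block v (-i) (-j) = (block v i j).map (starRingEnd ℂ) := by
  ext c d
  exact (exists_dftTensor_iff v).1 hv c i j d

theorem endToEnd_dft_mem_feasible (w : Weights ℝ C K H W) :
    w.dft.endToEnd ∈ feasible C K H W := by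
  refine ⟨(exists_dftTensor_iff _).2 fun c i j d => ?_, fun i j => rank_block_endToEnd_le _ i j⟩
  have h : block w.dft.endToEnd (-i) (-j) = (block w.dft.endToEnd i j).map (starRingEnd ℂ) := by
    rw [Weights.block_endToEnd, Weights.block_endToEnd, Matrix.map_mul, ← chain_map,
      block_neg (v := w.dft.final) ⟨w.final, rfl⟩]
    congr 2
    funext l
    exact block_neg ⟨w.layer l, rfl⟩ i j
  exact congrFun (congrFun h c) d

theorem freqNet_eq_iff (w : Weights ℂ C K H W) (v : Tensor ℂ K H W (C 0)) :
    (∀ z : Image ℝ (C 0) H W, w.freqNet (dftImage z) = contract v (dftImage z))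
      ↔ w.endToEnd = v := by
  simp only [Weights.freqNet_eq_contract]
  exact ⟨eq_of_contract_dftImage_eq, fun h z => by rw [h]⟩

theorem schattenPenalty_le_sqNormSum (w : Weights ℂ C K H W) :
    ((n + 1 : ℕ) : ℝ) * schattenPenalty (n + 1) w.endToEnd ≤ w.sqNormSum := by
  rw [Weights.sqNormSum_eq_sum, schattenPenalty, Finset.mul_sum]
  refine Finset.sum_le_sum fun i _ => ?_
  rw [Finset.mul_sum]
  refine Finset.sum_le_sum fun j _ => ?_
  exact schatten_le_of_chain (r := min (⨅ l, C l) K) _ (rank_block_endToEnd_le w i j)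
    (fun l => (min_le_left _ _).trans (ciInf_le' C l)) (min_le_right _ _) _ _ rfl

theorem exists_weights_of_mem_feasible {v : Tensor ℂ K H W (C 0)} (hv : v ∈ feasible C K H W) :
    ∃ w : Weights ℝ C K H W, w.dft.endToEnd = v ∧
      w.dft.sqNormSum = ((n + 1 : ℕ) : ℝ) * schattenPenalty (n + 1) v := by
  obtain ⟨hdft, hrank⟩ := hv
  have hC : ∀ l, min (⨅ l, C l) K ≤ C l := fun l => (min_le_left _ _).trans (ciInf_le' C l)
  have hK : min (⨅ l, C l) K ≤ K := min_le_right _ _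
  have hnorm : ∀ x, ‖starRingEnd ℂ x‖ = ‖x‖ := fun x => RCLike.norm_conj x
  obtain ⟨f, hf⟩ := exists_equivariant_choice (α := ZMod H × ZMod W)
    (β := (∀ l : Fin n, Matrix (Fin (C l.succ)) (Fin (C l.castSucc)) ℂ) ×
      Matrix (Fin K) (Fin (C (Fin.last n))) ℂ)
    (σ := fun q => -q)
    (τ := fun M => (fun l => (M.1 l).map (starRingEnd ℂ), M.2.map (starRingEnd ℂ)))
    (P := fun q M => M.2 * chain M.1 (Fin.last n) = block v q.1 q.2 ∧
      (∑ l, frobSq (M.1 l)) + frobSq M.2 = ((n + 1 : ℕ) : ℝ) *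
        schatten (2 / ((n + 1 : ℕ) : ℝ)) (block v q.1 q.2) ^ (2 / ((n + 1 : ℕ) : ℝ)))
    neg_involutive
    (fun M => by
      refine Prod.ext (funext fun l => ?_) ?_ <;>
      · ext c d
        simp)
    -- Conjugating optimal factors at `q` gives optimal factors at `-q`.
    (fun q M hM => by
      refine ⟨?_, ?_⟩
      · rw [chain_map, ← Matrix.map_mul, hM.1]
        exact (block_neg hdft q.1 q.2).symm
      · simp only [frobSq_map _ hnorm]
        rw [hM.2, Prod.fst_neg, Prod.snd_neg, block_neg hdft,
          schatten_map_conj _ (hrank q.1 q.2) hC hK])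
    (fun q => by
      obtain ⟨M, F, h⟩ := exists_chain_schatten _ (hrank q.1 q.2) hC hK
      exact ⟨(M, F), h⟩)
    (fun q hq => by
      -- At a frequency with `-q = q` the block equals its conjugate, hence is real.
      obtain ⟨B, hB⟩ : ∃ B : Matrix (Fin K) (Fin (C 0)) ℝ,
          B.map Complex.ofRealHom = block v q.1 q.2 := by
        refine ⟨(block v q.1 q.2).map Complex.re, ?_⟩
        have h := block_neg hdft q.1 q.2
        rw [← Prod.fst_neg, ← Prod.snd_neg, hq] at h
        ext c d
        exact Complex.conj_eq_iff_re.1 (congrFun (congrFun h c) d).symm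
      obtain ⟨M, F, h1, h2⟩ := exists_real_chain_schatten B (hB ▸ hrank q.1 q.2) hC hK
      refine ⟨(fun l => (M l).map Complex.ofRealHom, F.map Complex.ofRealHom), ⟨?_, ?_⟩, ?_⟩
      · rw [chain_map, ← Matrix.map_mul, h1, hB]
      · simp only [frobSq_map Complex.ofRealHom (fun x => Complex.norm_real x)]
        rw [h2, hB]
      · refine Prod.ext (funext fun l => ?_) ?_ <;>
        · ext c d
          simp)
  have hneg : ∀ (i : ZMod H) (j : ZMod W), f (-i, -j) = _ := fun i j => (hf (i, j)).2
  have hlayer : ∀ l, ∃ u : Tensor ℝ (C l.succ) H W (C l.castSucc),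
      (fun c i j d => (f (i, j)).1 l c d) = dftTensor u := fun l => by
    rw [exists_dftTensor_iff]
    intro c i j d
    rw [hneg]
    rfl
  have hfinal : ∃ u : Tensor ℝ K H W (C (Fin.last n)),
      (fun c i j d => (f (i, j)).2 c d) = dftTensor u := by
    rw [exists_dftTensor_iff]
    intro c i j d
    rw [hneg]
    rfl
  choose u hu using hlayer
  obtain ⟨u', hu'⟩ := hfinal
  have hbl : ∀ l i j, block (dftTensor (u l)) i j = (f (i, j)).1 l := fun l i j => by
    rw [← hu]; rfl
  have hbf : ∀ i j, block (dftTensor u') i j = (f (i, j)).2 := fun i j => by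
    rw [← hu']; rfl
  refine ⟨⟨u, u'⟩, ?_, ?_⟩
  · have h : ∀ i j, block (Weights.endToEnd (Weights.dft ⟨u, u'⟩)) i j = block v i j := by
      intro i j
      rw [Weights.block_endToEnd]
      simp only [Weights.dft, hbl, hbf]
      exact (hf (i, j)).1.1
    funext c i j d
    exact congrFun (congrFun (h i j) c) d
  · rw [Weights.sqNormSum_eq_sum, schattenPenalty, Finset.mul_sum]
    refine Finset.sum_congr rfl fun i _ => ?_
    rw [Finset.mul_sum]
    refine Finset.sum_congr rfl fun j _ => ?_
    simp only [Weights.dft, hbl, hbf]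
    exact (hf (i, j)).1.2

/-- Scaling of all layers by `t` and spatial reflection of the last one. -/
def Weights.rescale (t : ℝ) (w : Weights ℝ C K H W) : Weights ℝ C K H W where
  layer l := t • w.layer l
  final := t • reflect w.final

omit [NeZero H] [NeZero W] in
theorem Weights.rescale_surjective {t : ℝ} (ht : t ≠ 0) :
    Function.Surjective (Weights.rescale (C := C) (K := K) (H := H) (W := W) t) := by
  intro w
  refine ⟨⟨fun l => t⁻¹ • w.layer l, reflect (t⁻¹ • w.final)⟩, ?_⟩
  simp only [rescale, reflect_reflect, smul_smul, mul_inv_cancel₀ ht, one_smul]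

theorem Weights.sqNormSum_rescale (t : ℝ) (w : Weights ℝ C K H W) :
    (w.rescale t).sqNormSum = t ^ 2 * w.sqNormSum := by
  simp only [sqNormSum, rescale, sqNorm_smul, sqNorm_reflect, mul_add, Finset.mul_sum]

theorem Weights.freqHidden_rescale (t : ℝ) (w : Weights ℝ C K H W) (x : Image ℝ (C 0) H W)
    (l : Fin (n + 1)) (c : Fin (C l)) (i : ZMod H) (j : ZMod W) :
    (√((H : ℝ) * W) : ℂ) ^ (l : ℕ) * (w.rescale t).dft.freqHidden (dftImage x) l c i j
      = (t : ℂ) ^ (l : ℕ) * dftImage (w.hidden x l) c i j := by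
  induction l using Fin.induction with
  | zero => simp [freqHidden, hidden]
  | succ l ih =>
    rw [freqHidden_succ, hidden_succ, dftImage_conv, Fin.val_succ]
    simp only [pointwise, Finset.mul_sum]
    refine Finset.sum_congr rfl fun d _ => ?_
    have h := ih d
    rw [Fin.val_castSucc] at h
    have hl : (w.rescale t).dft.layer l = (t : ℂ) • dftTensor (w.layer l) := dftTensor_smul t _
    rw [hl]
    simp only [Pi.smul_apply, smul_eq_mul]
    rw [pow_succ, pow_succ]
    linear_combination (√((H : ℝ) * W) : ℂ) * t * dftTensor (w.layer l) c i j d * h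

/-- The `n` convolutions produce √(HW)^n, while all `n + 1` layers are scaled by `t`; `ht` balances
the two. -/
theorem Weights.freqNet_rescale {t : ℝ} (ht : t ^ (n + 1) = √((H : ℝ) * W) ^ n)
    (w : Weights ℝ C K H W) (x : Image ℝ (C 0) H W) (k : Fin K) :
    (w.rescale t).dft.freqNet (dftImage x) k = ((w.cnn x k : ℝ) : ℂ) := by
  have hs : (√((H : ℝ) * W) : ℂ) ^ n ≠ 0 :=
    pow_ne_zero _ (by exact_mod_cast sqrt_mul_ne_zero H W)
  have ht' : (t : ℂ) ^ (n + 1) = (√((H : ℝ) * W) : ℂ) ^ n := by exact_mod_cast ht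
  apply mul_left_cancel₀ hs
  change _ = _ * ((contract w.final (w.hidden x (Fin.last n)) k : ℝ) : ℂ)
  rw [← contract_dft_reflect]
  change _ * contract (w.rescale t).dft.final
    ((w.rescale t).dft.freqHidden (dftImage x) (Fin.last n)) k = _
  have hl : (w.rescale t).dft.final = (t : ℂ) • dftTensor (reflect w.final) := dftTensor_smul t _
  rw [hl]
  simp only [contract, Finset.mul_sum]
  refine Finset.sum_congr rfl fun i _ => Finset.sum_congr rfl fun j _ =>
    Finset.sum_congr rfl fun d _ => ?_
  have h := w.freqHidden_rescale t x (Fin.last n) d i j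
  rw [Fin.val_last] at h
  rw [← ht'] at h ⊢
  simp only [Pi.smul_apply, smul_eq_mul]
  linear_combination (t : ℂ) * dftTensor (reflect w.final) k i j d * h

/-- Keeping `lam` general allows its reuse for the CNN with a rescaled penalty. -/
theorem equivalentMinimization_freqNet {N : ℕ}
    (loss : (Fin N → Fin K → ℝ) → (Fin N → Fin K → ℝ) → ℝ)
    (x : Fin N → Image ℝ (C 0) H W) (y : Fin N → Fin K → ℝ) (lam : ℝ) (hlam : 0 ≤ lam) :
    EquivalentMinimization
      (fun w : Weights ℝ C K H W =>
        loss (fun s k => (w.dft.freqNet (dftImage (x s)) k).re) y + lam * w.dft.sqNormSum)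
      (feasible C K H W)
      (fun v => loss (fun s k => (contract v (dftImage (x s)) k).re) y
          + lam * ((n + 1 : ℕ) : ℝ) * schattenPenalty (n + 1) v)
      (fun w v => ∀ z, w.dft.freqNet (dftImage z) = contract v (dftImage z)) := by
  simp only [freqNet_eq_iff]
  refine .of_isLeast (fun w => ⟨w.dft.endToEnd, ⟨endToEnd_dft_mem_feasible w, rfl⟩,
    fun v hv => hv.2.symm⟩) fun v hv => ⟨?_, ?_⟩
  · obtain ⟨w, hw, hc⟩ := exists_weights_of_mem_feasible hv
    refine ⟨w, hw, ?_⟩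
    simp only [Weights.freqNet_eq_contract, hw, hc, mul_assoc]
  · rintro _ ⟨w, rfl, rfl⟩
    simp only [Weights.freqNet_eq_contract, mul_assoc]
    gcongr
    exact schattenPenalty_le_sqNormSum _

end Network

end LinearCNN

end

/-! ### The theorem -/

theorem mainTheorem1 {n K H W N : ℕ} [NeZero H] [NeZero W] (C : Fin (n + 1) → ℕ)
    (loss : (Fin N → Fin K → ℝ) → (Fin N → Fin K → ℝ) → ℝ)
    (x : Fin N → LinearCNN.Image ℝ (C 0) H W) (y : Fin N → Fin K → ℝ)
    (lam : ℝ) (hlam : 0 ≤ lam) :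
    -- all outputs that enter the loss below are real
    (∀ v ∈ LinearCNN.feasible C K H W, ∀ z k,
      (LinearCNN.contract v (LinearCNN.dftImage z) k).im = 0) ∧
    (∀ (w : LinearCNN.Weights ℝ C K H W) z k,
      (w.dft.freqNet (LinearCNN.dftImage z) k).im = 0) ∧
    -- the frequency space network with penalty on the Fourier transforms of the weights
    LinearCNN.EquivalentMinimization
      (fun w : LinearCNN.Weights ℝ C K H W =>
        loss (fun s k => (w.dft.freqNet (LinearCNN.dftImage (x s)) k).re) y
          + lam * w.dft.sqNormSum)
      (LinearCNN.feasible C K H W)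
      (fun v => loss (fun s k => (LinearCNN.contract v (LinearCNN.dftImage (x s)) k).re) y
          + lam * ((n + 1 : ℕ) : ℝ) * LinearCNN.schattenPenalty (n + 1) v)
      (fun w v => ∀ z, w.dft.freqNet (LinearCNN.dftImage z)
          = LinearCNN.contract v (LinearCNN.dftImage z)) ∧
    -- the convolutional network with penalty on the weights
    LinearCNN.EquivalentMinimization
      (fun w : LinearCNN.Weights ℝ C K H W =>
        loss (fun s => w.cnn (x s)) y + lam * w.sqNormSum)
      (LinearCNN.feasible C K H W)
      (fun v => loss (fun s k => (LinearCNN.contract v (LinearCNN.dftImage (x s)) k).re) y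
          + lam * ((n + 1 : ℕ) : ℝ)
            * (((H : ℝ) * (W : ℝ)) ^ (-((n : ℝ) / ((n + 1 : ℕ) : ℝ)))
              * LinearCNN.schattenPenalty (n + 1) v))
      (fun w v => ∀ z k, (w.cnn z k : ℂ) = LinearCNN.contract v (LinearCNN.dftImage z) k) := by
  have him : ∀ v ∈ LinearCNN.feasible C K H W, ∀ z k,
      (LinearCNN.contract v (LinearCNN.dftImage z) k).im = 0 :=
    fun v hv z k => LinearCNN.contract_im_eq_zero v hv.1 z k
  refine ⟨him, fun w z k => ?_,
    LinearCNN.equivalentMinimization_freqNet loss x y lam hlam, ?_⟩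
  · rw [LinearCNN.Weights.freqNet_eq_contract]
    exact him _ (LinearCNN.endToEnd_dft_mem_feasible w) z k
  have hHW : (0 : ℝ) < (H : ℝ) * W := by
    have hH : (0 : ℝ) < H := by exact_mod_cast NeZero.pos H
    have hW : (0 : ℝ) < W := by exact_mod_cast NeZero.pos W
    positivity
  have hn : ((n + 1 : ℕ) : ℝ) ≠ 0 := by positivity
  -- The positive solution of t^L = √(HW)^(L-1). Squared norms scale by t², which the factor
  -- (HW)^(-(L-1)/L) in the penalty cancels.
  set t : ℝ := √((H : ℝ) * W) ^ ((n : ℝ) / ((n + 1 : ℕ) : ℝ)) with ht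
  have htpos : 0 < t := by positivity
  have htn : t ^ (n + 1) = √((H : ℝ) * W) ^ n := by
    rw [ht, ← Real.rpow_natCast, ← Real.rpow_mul (Real.sqrt_nonneg _), div_mul_cancel₀ _ hn,
      Real.rpow_natCast]
  have ht2 : ((H : ℝ) * W) ^ (-((n : ℝ) / ((n + 1 : ℕ) : ℝ))) * t ^ 2 = 1 := by
    rw [ht, Real.rpow_pow_comm (Real.sqrt_nonneg _), Real.sq_sqrt hHW.le, ← Real.rpow_add hHW,
      neg_add_cancel, Real.rpow_zero]
  have h := (LinearCNN.equivalentMinimization_freqNet (C := C) loss x y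
    (lam * ((H : ℝ) * W) ^ (-((n : ℝ) / ((n + 1 : ℕ) : ℝ)))) (by positivity)).comp
    (LinearCNN.Weights.rescale_surjective htpos.ne')
  convert h using 1
  · funext w
    simp only [LinearCNN.Weights.freqNet_rescale htn, Complex.ofReal_re,
      LinearCNN.Weights.sqNormSum_dft, LinearCNN.Weights.sqNormSum_rescale]
    linear_combination (-lam * w.sqNormSum) * ht2
  · funext v
    ring
  · funext w v
    simp only [funext_iff, LinearCNN.Weights.freqNet_rescale htn]
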